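/- Let $n\ge 1$, $\epsilon\in\{1,-1\}$, $H>0$, and equip $\mathbb R^{n+1}$, with cartesian coordinates $y^0,\dots,y^n$ and the orientation $dy^0\wedge\dots\wedge dy^n$, with the metric $\eta=\mathrm{diag}(+,-,\dots,-,-\epsilon)$. Let $\Sigma=\{y:\ y^2:=\eta(y,y)=-\epsilon H^{-2}\}$ be the de Sitter ($\epsilon=1$) or Anti-de Sitter ($\epsilon=-1$) space, with the induced metric, and let $m:\Sigma\to\mathbb R^{n+1}$ be the inclusion. On the open cone $C=\{-\epsilon y^2>0\}$ put $h=|y^2|^{-1/2}$ (so $h=H$ on $\Sigma$), $D=y^A\partial_A$, $e_n=hD$, $e^n=d(h^{-1})$, and $\eta^{nn}=-\epsilon$; $\Sigma$ is oriented by its exterior normal $e_n$ (a frame $(v_0,\dots,v_{n-1})$ of $T_y\Sigma$ is direct if $(v_0,\dots,v_{n-1},e_n)$ is direct). On both spaces $\delta=(-1)^b *^{-1}d\,*$ on $b$-forms (zero on functions) and $\square=-(d\delta+\delta d)$. For $s\in\mathbb R$ let $\Omega^b_{s\perp}$ be the set of smooth $b$-forms $\alpha$ on $C$ that are transverse, i.e.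 $i_{e_n}\alpha=0$, and $s$-homogeneous, i.e. the pullback of $\alpha$ by the dilation $y\mapsto cy$ is $c^s\alpha$ for every $c>0$. At each point $y\in\Sigma$, forms on $T_y\Sigma$ are identified with transverse forms on $\mathbb R^{n+1}$ (those annihilated by $i_{e_n}$) by restriction. Let $b\ge 0$, $s\in\mathbb R$, let $\beta$ be a smooth $b$-form on $\Sigma$ and $\beta_s$ its transverse $s$-homogeneous extension, that is $\beta_s\in\Omega^b_{s\perp}$ and $m^*\beta_s=\beta$. Then: (i) $\delta_\Sigma\beta=\delta_{n+1}\beta_s$ at every point of $\Sigma$, and $\delta_{n+1}\beta_s\in\Omega^{b-1}_{s-2\,\perp}$; (ii) at every point of $\Sigma$, $$\square_\Sigma\beta=\square_{n+1}\beta_s-\eta^{nn}H^2\,s(s+n-1-2b)\,\beta_s-2H\,e^n\wedge\delta_{n+1}\beta_s,$$ and the form $\square_{n+1}\beta_s-\eta^{nn}h^2\,s(s+n-1-2b)\,\beta_s-2h\,e^n\wedge\delta_{n+1}\beta_s$ on $C$ belongs to $\Omega^{b}_{s-2\,\perp}$. -/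

import Mathlib

open scoped ContDiff Nat

noncomputable section

namespace DS

/-! ## Linear algebra of a pseudo-Euclidean vector space -/

section Hodge

variable {V : Type*} [NormedAddCommGroup V] [NormedSpace ℝ V]

/-- The iterated interior product `i_{u_{p-1}} ⋯ i_{u_1} i_{u_0} w`. -/
def contract {q : ℕ} : (p : ℕ) → V [⋀^Fin (q + p)]→L[ℝ] ℝ → (Fin p → V) → V [⋀^Fin q]→L[ℝ] ℝ
  | 0, w, _ => w
  | p + 1, w, u => contract p (ContinuousAlternatingMap.curryLeft w (u 0)) (fun i => u i.succ)

variable [FiniteDimensional ℝ V]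

/-- For the chosen basis `(e_j)` of `V`, with dual basis `(e^i)`, the vector `♯ e^i = g^{ij} e_j`,
where `(g^{ij})` is the inverse of the Gram matrix `g(e_i, e_j)`. -/
def raisedBasis (g : LinearMap.BilinForm ℝ V) (i : Fin (Module.finrank ℝ V)) : V :=
  ∑ j, (LinearMap.BilinForm.toMatrix (Module.finBasis ℝ V) g)⁻¹ i j • Module.finBasis ℝ V j

/-- The Hodge operator `Λ^p V* → Λ^q V*`, `p + q = m`, of a vector space of dimension `m` with
nondegenerate symmetric form `g` and volume form `w`: the linear operator with
`*(e^{a_1} ∧ ⋯ ∧ e^{a_p}) = i^{a_p} ⋯ i^{a_1} w`, that is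
`* α = (1 / p!) ∑ α_{a_1 ⋯ a_p} i^{a_p} ⋯ i^{a_1} w`, where `i^a` is the interior product with
`♯ e^a` (the sum does not depend on the basis). -/
def hodgeStar (g : LinearMap.BilinForm ℝ V) {m : ℕ} (w : V [⋀^Fin m]→L[ℝ] ℝ) {p q : ℕ}
    (h : m = q + p) (α : V [⋀^Fin p]→L[ℝ] ℝ) : V [⋀^Fin q]→L[ℝ] ℝ :=
  ((p ! : ℝ))⁻¹ • ∑ I : Fin p → Fin (Module.finrank ℝ V),
    α (fun k => Module.finBasis ℝ V (I k)) •
      contract p (h ▸ w : V [⋀^Fin (q + p)]→L[ℝ] ℝ) (fun k => raisedBasis g (I k))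

/-- The inverse `*⁻¹ : Λ^q V* → Λ^p V*` of the Hodge operator `* : Λ^p V* → Λ^q V*`
(which is bijective as soon as `g` is nondegenerate, `w ≠ 0` and `m = dim V`). -/
def hodgeStarInv (g : LinearMap.BilinForm ℝ V) {m : ℕ} (w : V [⋀^Fin m]→L[ℝ] ℝ) {p q : ℕ}
    (h : m = q + p) : V [⋀^Fin q]→L[ℝ] ℝ → V [⋀^Fin p]→L[ℝ] ℝ :=
  Function.invFun (hodgeStar g w h)

end Hodge

/-! ## The ambient space -/

/-- The ambient space `ℝ^{n+1}`, with cartesian coordinates `y 0, …, y n`. -/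
abbrev Ambient (n : ℕ) : Type := Fin (n + 1) → ℝ

/-- The diagonal coefficients of `η = diag(+, -, …, -, -ε)`. -/
def signs (n : ℕ) (ε : ℝ) (A : Fin (n + 1)) : ℝ :=
  if A = 0 then 1 else if A = Fin.last n then -ε else -1

/-- The ambient metric `η`. -/
def metric (n : ℕ) (ε : ℝ) : LinearMap.BilinForm ℝ (Ambient n) :=
  Matrix.toBilin' (Matrix.diagonal (signs n ε))

/-- The volume form `dy^0 ∧ ⋯ ∧ dy^n` of the ambient space. -/
def vol (n : ℕ) : Ambient n [⋀^Fin (n + 1)]→L[ℝ] ℝ :=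
  { (Pi.basisFun ℝ (Fin (n + 1))).det with
    cont := by
      change Continuous fun v : Fin (n + 1) → Ambient n => (Pi.basisFun ℝ (Fin (n + 1))).det v
      simp only [Module.Basis.det_apply]
      refine Continuous.matrix_det ?_
      refine continuous_matrix fun i j => ?_
      simp only [Module.Basis.toMatrix_apply, Pi.basisFun_repr]
      fun_prop }

/-- The open cone `{-ε y² > 0}`, union of the open half-lines from the origin that meet `Σ`. -/
def cone (n : ℕ) (ε : ℝ) : Set (Ambient n) := {y | 0 < -ε * metric n ε y y}

/-- The function `h = 1 / √|y²|`. -/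
def hFun (n : ℕ) (ε : ℝ) (y : Ambient n) : ℝ := (Real.sqrt |metric n ε y y|)⁻¹

/-- The vector field `e_n = h D`, with `D = y^A ∂_A` the dilation vector field. -/
def normalVec (n : ℕ) (ε : ℝ) (y : Ambient n) : Ambient n := hFun n ε y • y

/-- The one-form `e^n = d(h⁻¹)`. -/
def normalForm (n : ℕ) (ε : ℝ) (y : Ambient n) : Ambient n →L[ℝ] ℝ :=
  fderiv ℝ (fun z => (hFun n ε z)⁻¹) y

/-- Differential `b`-forms on the ambient space. Forms that are only defined on the (open) cone are
represented by arbitrary values outside of it, which are never used. -/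
abbrev AForm (n b : ℕ) : Type := Ambient n → Ambient n [⋀^Fin b]→L[ℝ] ℝ

/-- The wedge product `e^n ∧ α`. -/
def normalWedge {n p : ℕ} (ε : ℝ) (α : AForm n p) : AForm n (p + 1) := fun y =>
  ContinuousAlternatingMap.alternatizeUncurryFin ((normalForm n ε y).smulRight (α y))

/-- The ambient Hodge operator `*_{n+1}` from `p`-forms to `q`-forms, `p + q = n + 1`. -/
def starA {n : ℕ} (ε : ℝ) {p q : ℕ} (h : n + 1 = q + p) (α : AForm n p) : AForm n q := fun y =>
  hodgeStar (metric n ε) (vol n) h (α y)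

/-- The inverse of the ambient Hodge operator from `p`-forms to `q`-forms. -/
def starInvA {n : ℕ} (ε : ℝ) {p q : ℕ} (h : n + 1 = q + p) (α : AForm n q) : AForm n p := fun y =>
  hodgeStarInv (metric n ε) (vol n) h (α y)

/-- The ambient codifferential `δ_{n+1} = (-1)^{p+1} *⁻¹ d *` on `(p + 1)`-forms
(zero if `p + 1 > n + 1`, where all `(p + 1)`-forms are zero). -/
def codiffSucc {n : ℕ} (ε : ℝ) {p : ℕ} (α : AForm n (p + 1)) : AForm n p :=
  if hp : p + 1 ≤ n + 1 then fun y =>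
    (-1 : ℝ) ^ (p + 1) •
      starInvA (p := p) (q := n - p + 1) ε (by omega)
        (extDeriv (starA (p := p + 1) (q := n - p) ε (by omega) α)) y
  else fun _ => 0

/-- The ambient codifferential `δ_{n+1}` on `b`-forms, equal to zero on functions. -/
def codiff {n : ℕ} (ε : ℝ) : {b : ℕ} → AForm n b → AForm n (b - 1)
  | 0, _ => fun _ => 0
  | _ + 1, α => codiffSucc ε α

/-- The ambient Laplace-de Rham operator `□_{n+1} = -(d δ + δ d)`. -/
def box {n : ℕ} (ε : ℝ) : {b : ℕ} → AForm n b → AForm n b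
  | 0, α => fun y => -(codiffSucc ε (extDeriv α) y)
  | _ + 1, α => fun y => -(extDeriv (codiffSucc ε α) y + codiffSucc ε (extDeriv α) y)

/-- The `b`-form `e^n ∧ δ_{n+1} α` (zero for `b = 0`, where `δ_{n+1} α = 0`). -/
def normalWedgeCodiff {n : ℕ} (ε : ℝ) : {b : ℕ} → AForm n b → AForm n b
  | 0, _ => fun _ => 0
  | _ + 1, α => normalWedge ε (codiffSucc ε α)

/-- The set `Ω^b_{s ⊥}` of smooth, transverse and `s`-homogeneous `b`-forms on the cone. -/
structure IsTransverseHomogeneous {n b : ℕ} (ε s : ℝ) (α : AForm n b) : Prop where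
  smooth : ContDiffOn ℝ ∞ α (cone n ε)
  /-- `i_n α = 0`: `α` vanishes when one of its arguments is `e_n`. -/
  transverse : ∀ y ∈ cone n ε, ∀ (v : Fin b → Ambient n) (i : Fin b),
    v i = normalVec n ε y → α y v = 0
  /-- The pullback of `α` by the dilation of ratio `c` is `c ^ s • α`. -/
  homogeneous : ∀ y ∈ cone n ε, ∀ c : ℝ, 0 < c →
    (α (c • y)).compContinuousLinearMap (c • ContinuousLinearMap.id ℝ (Ambient n)) = c ^ s • α y

/-! ## The (Anti-)de Sitter space `Σ` -/

/-- The (Anti-)de Sitter space `Σ = {y² = -ε H⁻²}`. -/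
def space (n : ℕ) (ε H : ℝ) : Set (Ambient n) := {y | metric n ε y y = -ε * (H ^ 2)⁻¹}

/-- The tangent space of `Σ` at `y`, as a subspace of `ℝ^{n+1}`: the kernel of the differential
at `y` of `z ↦ z²`, i.e. the orthogonal of `y`. -/
abbrev Tan {n : ℕ} (ε : ℝ) (y : Ambient n) : Submodule ℝ (Ambient n) :=
  LinearMap.ker (metric n ε y)

/-- The orthogonal projection of `ℝ^{n+1}` onto the orthogonal of `y` (for `y² ≠ 0`). -/
def proj {n : ℕ} (ε : ℝ) (y : Ambient n) : Ambient n →L[ℝ] Tan ε y :=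
  open Classical in
  if hy : metric n ε y y ≠ 0 then
    LinearMap.toContinuousLinearMap
      (LinearMap.codRestrict (Tan ε y)
        (LinearMap.id - ((metric n ε y y)⁻¹ • metric n ε y).smulRight y)
        (fun v => by
          rw [LinearMap.mem_ker]
          simp only [LinearMap.sub_apply, LinearMap.id_apply, LinearMap.smulRight_apply,
            LinearMap.smul_apply, map_sub, map_smul, smul_eq_mul]
          field_simp
          ring))
  else 0

/-- Differential `b`-forms on `Σ`: a `b`-form on each tangent space. -/
abbrev SForm (n : ℕ) (ε H : ℝ) (b : ℕ) : Type :=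
  (y : space n ε H) → Tan ε (y : Ambient n) [⋀^Fin b]→L[ℝ] ℝ

/-- The pullback `m^*` of ambient forms by the canonical injection `m : Σ → ℝ^{n+1}`. -/
def pullback {n : ℕ} (ε H : ℝ) {b : ℕ} (α : AForm n b) : SForm n ε H b := fun y =>
  (α y).compContinuousLinearMap (Tan ε (y : Ambient n)).subtypeL

/-- The identification, at each point `y` of `Σ`, of a `b`-form on `T_y Σ` with the transverse
`b`-form on `ℝ^{n+1}` that restricts to it. -/
def toAmbient {n : ℕ} {ε H : ℝ} {b : ℕ} (β : SForm n ε H b) (y : space n ε H) :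
    Ambient n [⋀^Fin b]→L[ℝ] ℝ :=
  (β y).compContinuousLinearMap (proj ε (y : Ambient n))

open Classical in
/-- The local parametrization of `Σ` around `y` by its tangent space at `y`,
`v ↦ v + √(1 - v² / y²) y`: the local inverse of the orthogonal projection of `Σ` onto `T_y Σ`.
It sends `0` to `y` and its derivative at `0` is the inclusion of `T_y Σ`. (The value `y` is used
for the vectors `v`, far from `0`, for which the formula does not give a point of `Σ`.) -/
def chart {n : ℕ} {ε H : ℝ} (y : space n ε H) (v : Tan ε (y : Ambient n)) : space n ε H :=
  if hv : (v : Ambient n) + Real.sqrt (1 - metric n ε v v / metric n ε y y) • (y : Ambient n) ∈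
      space n ε H then
    ⟨_, hv⟩
  else y

/-- The pullback of a form on `Σ` by the local parametrization around `y`. (The projection only
serves to view the derivative of the parametrization as a map into the tangent space of `Σ`.) -/
def inChart {n : ℕ} {ε H : ℝ} {b : ℕ} (β : SForm n ε H b) (y : space n ε H) :
    Tan ε (y : Ambient n) → Tan ε (y : Ambient n) [⋀^Fin b]→L[ℝ] ℝ := fun v =>
  (β (chart y v)).compContinuousLinearMap
    ((proj ε (chart y v : Ambient n)).comp
      (fderiv ℝ (fun w : Tan ε (y : Ambient n) => (chart y w : Ambient n)) v))

/-- Smooth forms on `Σ`: those that are smooth in the local parametrization around each point. -/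
def SmoothForm {n : ℕ} {ε H : ℝ} {b : ℕ} (β : SForm n ε H b) : Prop :=
  ∀ y : space n ε H, ContDiffAt ℝ ∞ (inChart β y) 0

/-- The exterior derivative `d_Σ`, computed at `y` in the local parametrization around `y`. -/
def extDerivS {n : ℕ} {ε H : ℝ} {b : ℕ} (β : SForm n ε H b) : SForm n ε H (b + 1) := fun y =>
  extDeriv (inChart β y) 0

/-- The metric of `Σ` at `y`: the restriction of `η`. -/
def metricS {n : ℕ} (ε : ℝ) (y : Ambient n) : LinearMap.BilinForm ℝ (Tan ε y) :=
  (metric n ε).restrict (Tan ε y)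

/-- The volume form of `Σ`, oriented by its exterior normal `e_n`: a frame `(e_0, …, e_{n-1})` of
`T_y Σ` is direct when `(e_0, …, e_{n-1}, e_n)` is a direct frame of `ℝ^{n+1}`, that is
`ω_Σ(v_0, …, v_{n-1}) = ω(v_0, …, v_{n-1}, e_n) = (-1)^n ω(e_n, v_0, …, v_{n-1})`. -/
def volS {n : ℕ} (ε : ℝ) (y : Ambient n) : Tan ε y [⋀^Fin n]→L[ℝ] ℝ :=
  (-1 : ℝ) ^ n • (ContinuousAlternatingMap.curryLeft (vol n)
    (normalVec n ε y)).compContinuousLinearMap (Tan ε y).subtypeL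

/-- The Hodge operator `*_Σ` from `p`-forms to `q`-forms, `p + q = n`. -/
def starS {n : ℕ} {ε H : ℝ} {p q : ℕ} (h : n = q + p) (β : SForm n ε H p) : SForm n ε H q :=
  fun y => hodgeStar (metricS ε (y : Ambient n)) (volS ε (y : Ambient n)) h (β y)

/-- The inverse of the Hodge operator `*_Σ` from `p`-forms to `q`-forms. -/
def starInvS {n : ℕ} {ε H : ℝ} {p q : ℕ} (h : n = q + p) (β : SForm n ε H q) : SForm n ε H p :=
  fun y => hodgeStarInv (metricS ε (y : Ambient n)) (volS ε (y : Ambient n)) h (β y)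

/-- The codifferential `δ_Σ = (-1)^{p+1} *⁻¹ d *` on `(p + 1)`-forms on `Σ`
(zero if `p + 1 > n`, where all `(p + 1)`-forms are zero). -/
def codiffSSucc {n : ℕ} {ε H : ℝ} {p : ℕ} (β : SForm n ε H (p + 1)) : SForm n ε H p :=
  if hp : p + 1 ≤ n then fun y =>
    (-1 : ℝ) ^ (p + 1) •
      starInvS (p := p) (q := n - (p + 1) + 1) (by omega)
        (extDerivS (starS (p := p + 1) (q := n - (p + 1)) (by omega) β)) y
  else fun _ => 0

/-- The codifferential `δ_Σ` on `b`-forms on `Σ`, equal to zero on functions. -/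
def codiffS {n : ℕ} {ε H : ℝ} : {b : ℕ} → SForm n ε H b → SForm n ε H (b - 1)
  | 0, _ => fun _ => 0
  | _ + 1, β => codiffSSucc β

/-- The Laplace-de Rham operator `□_Σ = -(d δ + δ d)` of `Σ`. -/
def boxS {n : ℕ} {ε H : ℝ} : {b : ℕ} → SForm n ε H b → SForm n ε H b
  | 0, β => fun y => -(codiffSSucc (extDerivS β) y)
  | _ + 1, β => fun y => -(extDerivS (codiffSSucc β) y + codiffSSucc (extDerivS β) y)

end DS

end

/-! # The codifferential and the Laplace-de Rham operator of (Anti-)de Sitter space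

Everything rests on two observations in linear algebra and two identities on the cone.

* In cartesian coordinates `δ_{n+1} α = -∑ η^{AA} i_A ∂_A α` (`codiffSucc_eq_divergence`). It
  follows from `g(u, ·) ∧ *α = (-1)^{p-1} *(i_u α)` on `p`-forms (`wedge_hodgeStar`), which also
  gives the injectivity of the Hodge operators, hence that `*⁻¹` is a left inverse.
* With `e_n` normal to `Σ`, the operator `*_Σ` is, up to sign, the restriction to `Σ` of `i_{e_n} *`
  (`starS_pullback`): the Hodge operator does not depend on the basis that is used to define it
  (`fullContract_eq`), and may be computed in a basis of `T_y Σ` completed by the normal.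

Let `α` be transverse and `s`-homogeneous, and let `D` be the dilation field. The exterior
derivative of `Σ` commutes with `m^*` (`extDerivS_pullback`), and Cartan's formula for `D` computes
`d i_D *α` in terms of `i_D d *α` and of multiples of `*α`, whose restriction to `Σ` vanishes
because `α` is transverse. Hence `δ_Σ m^*α = m^* δ_{n+1} α` (`codiffSSucc_pullback`). As `δ`
anticommutes with `i_D`, the form `δ_{n+1} α` is again transverse, so that it is determined by its
restriction.

For the second order operator, `dα` is not transverse: `i_D dα = s α`. Its transverse part is
`dα - s h e^n ∧ α`, which has the same restriction to `Σ` since `m^* e^n = 0`. Applying the result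
for `δ` to this form leaves the codifferential of `h e^n ∧ α = (y²)⁻¹ y_A dy^A ∧ α`, and
`δ(h e^n ∧ α) = -η^{nn} h² (s + n - 1 - 2b) α - h e^n ∧ δα`
(`IsTransverseHomogeneous.codiffSucc_radialWedge`). This gives the equality of the two sides
after restriction to `Σ` (`boxS_pullback`); the term `-2 h e^n ∧ δα`, invisible there, is the one
that makes the right-hand side transverse (`IsTransverseHomogeneous.box_sub`), because
`i_D □α = 2 δα` (`IsTransverseHomogeneous.curryLeft_box`).
-/

noncomputable section

namespace DS

open ContinuousAlternatingMap (curryLeft_same curryLeft_add curryLeft_smul curryLeftLI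
  curryLeft_apply_apply alternatizeUncurryFin alternatizeUncurryFinCLM alternatizeUncurryFin_apply
  compContinuousLinearMap_apply compContinuousLinearMapCLM compContinuousLinearMapCLM_apply
  curryLeft_compContinuousLinearMap alternatizeUncurryFinCLM_apply)

/-! ### Interior and exterior products -/

section Products

variable {V : Type*} [NormedAddCommGroup V] [NormedSpace ℝ V]

/-- The interior product `i_u`, as a continuous linear map `Λ^{q+1} V* → Λ^q V*`. -/
def interior (q : ℕ) (u : V) : V [⋀^Fin (q + 1)]→L[ℝ] ℝ →L[ℝ] V [⋀^Fin q]→L[ℝ] ℝ :=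
  (ContinuousLinearMap.apply ℝ (V [⋀^Fin q]→L[ℝ] ℝ) u).comp
    (curryLeftLI (𝕜 := ℝ) (E := V) (F := ℝ) (n := q)).toContinuousLinearMap

@[simp]
theorem interior_apply {q : ℕ} (u : V) (w : V [⋀^Fin (q + 1)]→L[ℝ] ℝ) :
    interior q u w = w.curryLeft u := rfl

/-- The exterior product `θ ∧ w` of a linear form and an alternating form. -/
def wedge {q : ℕ} (θ : V →L[ℝ] ℝ) (w : V [⋀^Fin q]→L[ℝ] ℝ) : V [⋀^Fin (q + 1)]→L[ℝ] ℝ :=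
  alternatizeUncurryFin (θ.smulRight w)

theorem wedge_apply {q : ℕ} (θ : V →L[ℝ] ℝ) (w : V [⋀^Fin q]→L[ℝ] ℝ) (v : Fin (q + 1) → V) :
    wedge θ w v = ∑ i : Fin (q + 1), (-1 : ℝ) ^ (i : ℕ) * (θ (v i) * w (i.removeNth v)) := by
  simp [wedge, alternatizeUncurryFin_apply, zsmul_eq_mul]

/-- `θ ∧ ·` as a continuous linear map. -/
def wedgeCLM (q : ℕ) (θ : V →L[ℝ] ℝ) : V [⋀^Fin q]→L[ℝ] ℝ →L[ℝ] V [⋀^Fin (q + 1)]→L[ℝ] ℝ :=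
  (alternatizeUncurryFinCLM ℝ V ℝ).comp (ContinuousLinearMap.smulRightL ℝ V _ θ)

@[simp]
theorem wedgeCLM_apply {q : ℕ} (θ : V →L[ℝ] ℝ) (w : V [⋀^Fin q]→L[ℝ] ℝ) :
    wedgeCLM q θ w = wedge θ w := rfl

theorem wedge_smul_left {q : ℕ} (c : ℝ) (θ : V →L[ℝ] ℝ) (w : V [⋀^Fin q]→L[ℝ] ℝ) :
    wedge (c • θ) w = c • wedge θ w := by
  ext v
  simp only [wedge_apply, _root_.smul_apply, ContinuousAlternatingMap.smul_apply,
    smul_eq_mul, Finset.mul_sum]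
  exact Finset.sum_congr rfl fun i _ => by ring

/-- `θ ∧ i_u w`, with the value zero on `0`-forms. -/
def wedgeInterior (θ : V →L[ℝ] ℝ) (u : V) : {q : ℕ} → V [⋀^Fin q]→L[ℝ] ℝ → V [⋀^Fin q]→L[ℝ] ℝ
  | 0, _ => 0
  | _ + 1, w => wedge θ (w.curryLeft u)

theorem curryLeft_curryLeft_swap {q : ℕ} (w : V [⋀^Fin (q + 2)]→L[ℝ] ℝ) (u v : V) :
    (w.curryLeft u).curryLeft v = -(w.curryLeft v).curryLeft u := by
  have h := curryLeft_same w (u + v)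
  simp only [map_add, curryLeft_add, _root_.add_apply, curryLeft_same, zero_add,
    add_zero] at h
  exact eq_neg_of_add_eq_zero_right h

/-- Contraction of the antisymmetrization of a linear map with values in forms of positive
degree. -/
theorem curryLeft_alternatizeUncurryFin {q : ℕ} (L : V →L[ℝ] V [⋀^Fin (q + 1)]→L[ℝ] ℝ) (u : V) :
    (alternatizeUncurryFin L).curryLeft u =
      L u - alternatizeUncurryFin ((interior q u).comp L) := by
  ext v
  simp only [curryLeft_apply_apply, ContinuousAlternatingMap.sub_apply, alternatizeUncurryFin_apply,
    ContinuousLinearMap.comp_apply, interior_apply]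
  rw [Fin.sum_univ_succ, sub_eq_add_neg, ← Finset.sum_neg_distrib]
  congr 1
  · simp [Matrix.vecCons]
  · refine Finset.sum_congr rfl fun i _ => ?_
    simp only [Matrix.vecCons, Fin.cons_succ, Fin.val_succ, pow_succ]
    rw [mul_neg_one, neg_smul]
    congr 3
    funext k
    cases k using Fin.cases <;> simp [Fin.removeNth]

theorem curryLeft_alternatizeUncurryFin_zero (L : V →L[ℝ] V [⋀^Fin 0]→L[ℝ] ℝ) (u : V) :
    (alternatizeUncurryFin L).curryLeft u = L u := by
  ext v
  simp only [curryLeft_apply_apply, alternatizeUncurryFin_apply]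
  rw [Fin.sum_univ_succ]
  simp [Matrix.vecCons]

theorem curryLeft_wedge {q : ℕ} (θ : V →L[ℝ] ℝ) (w : V [⋀^Fin q]→L[ℝ] ℝ) (u : V) :
    (wedge θ w).curryLeft u = θ u • w - wedgeInterior θ u w := by
  cases q with
  | zero => rw [wedge, curryLeft_alternatizeUncurryFin_zero]; simp [wedgeInterior]
  | succ q =>
    rw [wedge, curryLeft_alternatizeUncurryFin, wedgeInterior, wedge]
    rfl

theorem wedge_compContinuousLinearMap {W : Type*} [NormedAddCommGroup W] [NormedSpace ℝ W] {q : ℕ}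
    (θ : V →L[ℝ] ℝ) (w : V [⋀^Fin q]→L[ℝ] ℝ) (j : W →L[ℝ] V) :
    (wedge θ w).compContinuousLinearMap j =
      wedge (θ.comp j) (w.compContinuousLinearMap j) := by
  ext v
  simp only [compContinuousLinearMap_apply, wedge_apply]
  rfl

/-- Alternating forms of degree larger than the dimension vanish. -/
theorem eq_zero_of_finrank_lt [FiniteDimensional ℝ V] {q : ℕ} (hq : Module.finrank ℝ V < q)
    (w : V [⋀^Fin q]→L[ℝ] ℝ) : w = 0 := by
  ext v
  refine w.toAlternatingMap.map_linearDependent v fun h => ?_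
  have := h.fintype_card_le_finrank
  simp only [Fintype.card_fin] at this
  omega

theorem curryLeft_ext {q : ℕ} {w : V [⋀^Fin (q + 1)]→L[ℝ] ℝ} (h : ∀ u, w.curryLeft u = 0) :
    w = 0 := by
  ext v
  have := congrArg (fun f => f (fun i => v i.succ)) (h (v 0))
  simp only [curryLeft_apply_apply] at this
  rwa [show Matrix.vecCons (v 0) (fun i => v i.succ) = v from Fin.cons_self_tail v] at this

end Products

/-! ### The Hodge operator -/

section Contraction

variable {V : Type*} [NormedAddCommGroup V] [NormedSpace ℝ V]

/-- A pair of families `(a_k)`, `(b_k)` with `v = ∑ g(v, b_k) a_k` for all `v`, that is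
`∑ a_k ⊗ b_k = g⁻¹`. Such are a basis and the raised dual basis. -/
def IsReproducing (g : LinearMap.BilinForm ℝ V) {ι : Type*} [Fintype ι] (a b : ι → V) : Prop :=
  ∀ v, ∑ k, g v (b k) • a k = v

/-- A bilinear map takes the same value on all the representations of `g⁻¹`. -/
theorem IsReproducing.sum_eq {g : LinearMap.BilinForm ℝ V} (hg : ∀ u v, g u v = g v u)
    {ι κ : Type*} [Fintype ι] [Fintype κ] {a b : ι → V} {a' b' : κ → V}
    (h : IsReproducing g a b) (h' : IsReproducing g a' b') {W : Type*} [AddCommGroup W]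
    [Module ℝ W] (B : V →ₗ[ℝ] V →ₗ[ℝ] W) : ∑ k, B (a k) (b k) = ∑ l, B (a' l) (b' l) := by
  have key : ∀ x, ∑ k, g (a k) x • b k = x := by
    intro x
    have hz : ∀ v, g v (∑ k, g (a k) x • b k - x) = 0 := by
      intro v
      have h1 := congrArg (fun z => g z x) (h v)
      simp only [map_sum, map_smul, LinearMap.sum_apply, LinearMap.smul_apply, smul_eq_mul] at h1
      simp only [map_sub, map_sum, map_smul, smul_eq_mul]
      rw [sub_eq_zero, ← h1]
      exact Finset.sum_congr rfl fun i _ => by ring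
    have h2 := h (∑ k, g (a k) x • b k - x)
    rw [← sub_eq_zero, ← h2]
    exact Finset.sum_eq_zero fun k _ => by rw [hg, hz, zero_smul]
  calc ∑ k, B (a k) (b k) = ∑ k, B (∑ l, g (a k) (b' l) • a' l) (b k) := by simp only [h' _]
    _ = ∑ l, ∑ k, g (a k) (b' l) • B (a' l) (b k) := by
        rw [Finset.sum_comm]
        simp only [map_sum, map_smul, LinearMap.sum_apply, LinearMap.smul_apply]
    _ = ∑ l, B (a' l) (b' l) := by
        refine Finset.sum_congr rfl fun l _ => ?_
        rw [← congrArg (B (a' l)) (key (b' l))]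
        simp only [map_sum, map_smul]

/-- The contraction `∑ α_{k_1 ⋯ k_p} i_{b_{k_p}} ⋯ i_{b_{k_1}} w`, where the components of `α` are
taken with respect to the vectors `a_k`: this is `p!` times the Hodge dual of `α`. -/
def fullContract {ι : Type*} [Fintype ι] (a b : ι → V) {m p q : ℕ} (h : m = q + p)
    (w : V [⋀^Fin m]→L[ℝ] ℝ) (α : V [⋀^Fin p]→L[ℝ] ℝ) : V [⋀^Fin q]→L[ℝ] ℝ :=
  ∑ I : Fin p → ι, α (fun k => a (I k)) •
    contract p (h ▸ w : V [⋀^Fin (q + p)]→L[ℝ] ℝ) (fun k => b (I k))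

theorem contract_add {q p : ℕ} (w w' : V [⋀^Fin (q + p)]→L[ℝ] ℝ) (u : Fin p → V) :
    contract p (w + w') u = contract p w u + contract p w' u := by
  induction p with
  | zero => rfl
  | succ p ih => exact ih (w.curryLeft (u 0)) (w'.curryLeft (u 0)) _

theorem contract_smul {q p : ℕ} (c : ℝ) (w : V [⋀^Fin (q + p)]→L[ℝ] ℝ) (u : Fin p → V) :
    contract p (c • w) u = c • contract p w u := by
  induction p with
  | zero => rfl
  | succ p ih => exact ih (w.curryLeft (u 0)) _

section

variable {ι : Type*} [Fintype ι] (a b : ι → V)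

theorem fullContract_add_left {m p q : ℕ} (h : m = q + p) (w w' : V [⋀^Fin m]→L[ℝ] ℝ)
    (α : V [⋀^Fin p]→L[ℝ] ℝ) :
    fullContract a b h (w + w') α = fullContract a b h w α + fullContract a b h w' α := by
  subst h
  simp only [fullContract, contract_add, smul_add, Finset.sum_add_distrib]

theorem fullContract_smul_left {m p q : ℕ} (h : m = q + p) (c : ℝ) (w : V [⋀^Fin m]→L[ℝ] ℝ)
    (α : V [⋀^Fin p]→L[ℝ] ℝ) :
    fullContract a b h (c • w) α = c • fullContract a b h w α := by
  subst h
  simp only [fullContract, contract_smul, Finset.smul_sum]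
  exact Finset.sum_congr rfl fun I _ => smul_comm _ _ _

theorem fullContract_add_right {m p q : ℕ} (h : m = q + p) (w : V [⋀^Fin m]→L[ℝ] ℝ)
    (α α' : V [⋀^Fin p]→L[ℝ] ℝ) :
    fullContract a b h w (α + α') = fullContract a b h w α + fullContract a b h w α' := by
  simp only [fullContract, ContinuousAlternatingMap.add_apply, add_smul, Finset.sum_add_distrib]

theorem fullContract_smul_right {m p q : ℕ} (h : m = q + p) (c : ℝ) (w : V [⋀^Fin m]→L[ℝ] ℝ)
    (α : V [⋀^Fin p]→L[ℝ] ℝ) :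
    fullContract a b h w (c • α) = c • fullContract a b h w α := by
  simp only [fullContract, ContinuousAlternatingMap.smul_apply, smul_assoc, Finset.smul_sum]

/-- `fullContract` as a bilinear map. -/
def fullContractBilin {m p q : ℕ} (h : m = q + p) :
    (V [⋀^Fin m]→L[ℝ] ℝ) →ₗ[ℝ] (V [⋀^Fin p]→L[ℝ] ℝ) →ₗ[ℝ] (V [⋀^Fin q]→L[ℝ] ℝ) :=
  LinearMap.mk₂ ℝ (fullContract a b h) (fullContract_add_left a b h)
    (fullContract_smul_left a b h) (fullContract_add_right a b h) (fullContract_smul_right a b h)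

@[simp]
theorem fullContractBilin_apply {m p q : ℕ} (h : m = q + p) (w : V [⋀^Fin m]→L[ℝ] ℝ)
    (α : V [⋀^Fin p]→L[ℝ] ℝ) : fullContractBilin a b h w α = fullContract a b h w α := rfl

theorem fullContract_zero_deg {m : ℕ} (w : V [⋀^Fin m]→L[ℝ] ℝ)
    (α : V [⋀^Fin 0]→L[ℝ] ℝ) : fullContract a b (p := 0) rfl w α = α ![] • w := by
  simp only [fullContract, Fintype.sum_unique]
  congr 1
  exact congrArg α (Subsingleton.elim _ _)

/-- Contracting one index at a time. -/
theorem fullContract_succ {m p q : ℕ} (h : m + 1 = q + (p + 1)) (h' : m = q + p)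
    (w : V [⋀^Fin (m + 1)]→L[ℝ] ℝ) (α : V [⋀^Fin (p + 1)]→L[ℝ] ℝ) :
    fullContract a b h w α =
      ∑ i, fullContract a b h' (w.curryLeft (b i)) (α.curryLeft (a i)) := by
  subst h'
  simp only [fullContract]
  rw [← (Fin.consEquiv fun _ : Fin (p + 1) => ι).sum_comp, Fintype.sum_prod_type]
  refine Finset.sum_congr rfl fun i _ => Finset.sum_congr rfl fun I _ => ?_
  congr 1
  rw [curryLeft_apply_apply]
  congr 1
  funext k
  cases k using Fin.cases <;> simp [Fin.consEquiv]

end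

/-- The contraction is independent of the representation of `g⁻¹`. -/
theorem fullContract_eq {g : LinearMap.BilinForm ℝ V} (hg : ∀ u v, g u v = g v u)
    {ι κ : Type*} [Fintype ι] [Fintype κ] {a b : ι → V} {a' b' : κ → V}
    (hab : IsReproducing g a b) (hab' : IsReproducing g a' b') {m p q : ℕ} (h : m = q + p)
    (w : V [⋀^Fin m]→L[ℝ] ℝ) (α : V [⋀^Fin p]→L[ℝ] ℝ) :
    fullContract a b h w α = fullContract a' b' h w α := by
  induction p generalizing m with
  | zero =>
    obtain rfl : m = q := h
    exact (fullContract_zero_deg a b w α).trans (fullContract_zero_deg a' b' w α).symm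
  | succ p ih =>
    obtain ⟨m, rfl⟩ : ∃ k, m = k + 1 := ⟨q + p, h⟩
    have h' : m = q + p := by omega
    rw [fullContract_succ a b h h', fullContract_succ a' b' h h']
    simp only [ih h']
    exact hab.sum_eq hg hab'
      (((fullContractBilin a' b' h').flip.compl₁₂ α.curryLeft.toLinearMap w.curryLeft.toLinearMap))

theorem curryLeft_fullContract {ι : Type*} [Fintype ι] (a b : ι → V) {m p q : ℕ}
    (h : m + 1 = q + 1 + p) (h' : m = q + p)
    (w : V [⋀^Fin (m + 1)]→L[ℝ] ℝ) (α : V [⋀^Fin p]→L[ℝ] ℝ) (u : V) :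
    (fullContract a b h w α).curryLeft u =
      (-1 : ℝ) ^ p • fullContract a b h' (w.curryLeft u) α := by
  induction p generalizing m with
  | zero =>
    obtain rfl : m = q := h'
    rw [fullContract_zero_deg, fullContract_zero_deg]
    simp
  | succ p ih =>
    obtain ⟨m, rfl⟩ : ∃ k, m = k + 1 := ⟨q + p, h'⟩
    rw [fullContract_succ a b h (by omega), fullContract_succ a b h' (by omega)]
    rw [← interior_apply, map_sum, Finset.smul_sum]
    refine Finset.sum_congr rfl fun i _ => ?_
    rw [interior_apply, ih (by omega) (by omega), curryLeft_curryLeft_swap, pow_succ,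
      ← fullContractBilin_apply, map_neg]
    simp

/-- The linear form `g(u, ·)`. -/
def flat [FiniteDimensional ℝ V] (g : LinearMap.BilinForm ℝ V) (u : V) : V →L[ℝ] ℝ :=
  LinearMap.toContinuousLinearMap (g u)

@[simp]
theorem flat_apply [FiniteDimensional ℝ V] (g : LinearMap.BilinForm ℝ V) (u v : V) :
    flat g u v = g u v := rfl

theorem wedge_curryLeft {q : ℕ} (θ : V →L[ℝ] ℝ) (w : V [⋀^Fin (q + 1)]→L[ℝ] ℝ) (u : V) :
    wedge θ (w.curryLeft u) = θ u • w - (wedge θ w).curryLeft u := by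
  rw [curryLeft_wedge, wedgeInterior, sub_sub_cancel]

theorem wedge_fullContract_zero {ι : Type*} [Fintype ι] (a b : ι → V) (θ : V →L[ℝ] ℝ) {m q : ℕ}
    (h : m = q + 0) (h' : m + 1 = q + 1 + 0) (w : V [⋀^Fin m]→L[ℝ] ℝ) (α : V [⋀^Fin 0]→L[ℝ] ℝ) :
    wedge θ (fullContract a b h w α) = fullContract a b h' (wedge θ w) α := by
  obtain rfl : m = q := h
  rw [fullContract_zero_deg, fullContract_zero_deg, ← wedgeCLM_apply, map_smul, wedgeCLM_apply]

/-- The Leibniz rule for `g(u, ·) ∧ (∑ α_{k_1 ⋯ k_p} i_{b_{k_p}} ⋯ i_{b_{k_1}} w)`. -/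
theorem wedge_fullContract [FiniteDimensional ℝ V] {g : LinearMap.BilinForm ℝ V}
    {ι : Type*} [Fintype ι] {a b : ι → V} (hab : IsReproducing g a b) (u : V) {m p q : ℕ}
    (h : m + 1 = q + (p + 1)) (h' : m + 1 = q + 1 + p) (h'' : m + 2 = q + 1 + (p + 1))
    (w : V [⋀^Fin (m + 1)]→L[ℝ] ℝ) (α : V [⋀^Fin (p + 1)]→L[ℝ] ℝ) :
    wedge (flat g u) (fullContract a b h w α) =
      (-1 : ℝ) ^ p • ((p + 1 : ℝ) • fullContract a b h' w (α.curryLeft u) -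
        fullContract a b h'' (wedge (flat g u) w) α) := by
  -- the terms where `g(u, ·)` is paired with the contracting vector
  have key : ∀ {m p q : ℕ} (h' : m + 1 = q + 1 + p)
      (w : V [⋀^Fin (m + 1)]→L[ℝ] ℝ) (α : V [⋀^Fin (p + 1)]→L[ℝ] ℝ),
      ∑ i, flat g u (b i) • fullContract a b h' w (α.curryLeft (a i)) =
        fullContract a b h' w (α.curryLeft u) := by
    intro m p q h' w α
    conv_rhs => rw [← hab u]
    simp only [← fullContractBilin_apply, map_sum, map_smul, flat_apply]
  induction p generalizing m with
  | zero =>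
    rw [fullContract_succ a b h (by omega), ← wedgeCLM_apply, map_sum,
      fullContract_succ a b h'' h', ← key]
    simp only [wedgeCLM_apply]
    rw [pow_zero, one_smul, Nat.cast_zero, zero_add, one_smul, ← Finset.sum_sub_distrib]
    refine Finset.sum_congr rfl fun i _ => ?_
    rw [wedge_fullContract_zero a b _ _ h', wedge_curryLeft, ← fullContractBilin_apply, map_sub,
      map_smul]
    rfl
  | succ p ih =>
    obtain ⟨m, rfl⟩ : ∃ k, m = k + 1 := ⟨q + p, by omega⟩
    rw [fullContract_succ a b h (by omega), ← wedgeCLM_apply, map_sum,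
      fullContract_succ a b h'' h']
    simp only [wedgeCLM_apply]
    have e1 : ∀ i, wedge (flat g u) (fullContract a b (m := m + 1) (p := p + 1) (q := q) (by omega)
        (w.curryLeft (b i)) (α.curryLeft (a i))) =
        (-1 : ℝ) ^ (p + 1) • ((p + 1 : ℝ) • fullContract a b (m := m + 1) (q := q + 1) (by omega)
          (w.curryLeft (b i)) ((α.curryLeft u).curryLeft (a i)) +
          flat g u (b i) • fullContract a b h' w (α.curryLeft (a i)) -
          fullContract a b h' ((wedge (flat g u) w).curryLeft (b i)) (α.curryLeft (a i))) := by
      intro i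
      rw [ih (by omega) (by omega) (by omega), wedge_curryLeft, curryLeft_curryLeft_swap,
        ← fullContractBilin_apply, ← fullContractBilin_apply, map_neg, map_sub,
        LinearMap.sub_apply, map_smul, LinearMap.smul_apply]
      simp only [fullContractBilin_apply]
      module
    simp only [e1]
    rw [← Finset.smul_sum, Finset.sum_sub_distrib, Finset.sum_add_distrib, key, ← Finset.smul_sum,
      ← fullContract_succ _ _ (by omega)]
    push_cast
    module

/-- Restriction of a contraction to a complement of a vector `e` with `i_e w = 0`. -/
theorem fullContract_comp {W : Type*} [NormedAddCommGroup W] [NormedSpace ℝ W]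
    {ι : Type*} [Fintype ι] (a b : ι → W) (j : W →L[ℝ] V) (e f : V) {m p q : ℕ} (h : m = q + p)
    (w : V [⋀^Fin m]→L[ℝ] ℝ) 
    (hw : ∀ (v : Fin m → V) (i : Fin m), v i = f → w v = 0)
    (α : V [⋀^Fin p]→L[ℝ] ℝ) :
    (fullContract (fun o : Option ι => o.elim e fun i => j (a i))
      (fun o : Option ι => o.elim f fun i => j (b i)) h w α).compContinuousLinearMap j =
    fullContract a b h (w.compContinuousLinearMap j) (α.compContinuousLinearMap j) := by
  induction p generalizing m with
  | zero =>
    obtain rfl : m = q := h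
    rw [fullContract_zero_deg, fullContract_zero_deg]
    ext v
    simp only [compContinuousLinearMap_apply, ContinuousAlternatingMap.smul_apply]
    exact congrArg₂ _ (congrArg α (Subsingleton.elim _ _)) rfl
  | succ p ih =>
    obtain ⟨m, rfl⟩ : ∃ k, m = k + 1 := ⟨q + p, by omega⟩
    rw [fullContract_succ _ _ h (by omega), fullContract_succ _ _ h (by omega),
      Fintype.sum_option, ← compContinuousLinearMapCLM_apply, map_add, map_sum]
    have h0 : w.curryLeft f = 0 := by
      ext v
      exact hw _ 0 rfl
    simp only [Option.elim_none, Option.elim_some] at h0 ⊢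
    rw [h0, ← fullContractBilin_apply, map_zero, LinearMap.zero_apply, map_zero, zero_add]
    refine Finset.sum_congr rfl fun i _ => ?_
    rw [compContinuousLinearMapCLM_apply, ih, curryLeft_compContinuousLinearMap,
      curryLeft_compContinuousLinearMap]
    exact fun v k hk => hw _ k.succ hk

end Contraction

section Hodge

variable {V : Type*} [NormedAddCommGroup V] [NormedSpace ℝ V] [FiniteDimensional ℝ V]

theorem isReproducing_raisedBasis {g : LinearMap.BilinForm ℝ V} (hg : ∀ u v, g u v = g v u)
    (hnd : g.Nondegenerate) : IsReproducing g (Module.finBasis ℝ V) (raisedBasis g) := by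
  intro v
  set e := Module.finBasis ℝ V
  set G := LinearMap.BilinForm.toMatrix e g with hG
  have hdet : IsUnit G.det :=
    isUnit_iff_ne_zero.2 ((LinearMap.BilinForm.nondegenerate_iff_det_ne_zero e).1 hnd)
  have h1 : ∀ k, ∑ i, g (e k) (raisedBasis g i) • e i = e k := by
    intro k
    have h2 : ∀ i, g (e k) (raisedBasis g i) = (1 : Matrix _ _ ℝ) i k := by
      intro i
      rw [← Matrix.nonsing_inv_mul G hdet, Matrix.mul_apply, raisedBasis, map_sum]
      refine Finset.sum_congr rfl fun j _ => ?_
      rw [map_smul, smul_eq_mul, hG, LinearMap.BilinForm.toMatrix_apply, hg]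
    simp [h2, Matrix.one_apply]
  have h3 : (∑ i, (g.flip (raisedBasis g i)).smulRight (e i)) = LinearMap.id := by
    refine e.ext fun k => ?_
    simpa using h1 k
  simpa using LinearMap.congr_fun h3 v

theorem hodgeStar_eq (g : LinearMap.BilinForm ℝ V) {m p q : ℕ} (w : V [⋀^Fin m]→L[ℝ] ℝ)
    (h : m = q + p) (α : V [⋀^Fin p]→L[ℝ] ℝ) :
    hodgeStar g w h α =
      ((p ! : ℝ))⁻¹ • fullContract (Module.finBasis ℝ V) (raisedBasis g) h w α := rfl

/-- The Hodge operator as a continuous linear map. -/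
def hodgeStarCLM (g : LinearMap.BilinForm ℝ V) {m p q : ℕ} (w : V [⋀^Fin m]→L[ℝ] ℝ)
    (h : m = q + p) : V [⋀^Fin p]→L[ℝ] ℝ →L[ℝ] V [⋀^Fin q]→L[ℝ] ℝ :=
  ((p ! : ℝ))⁻¹ • ∑ I : Fin p → Fin (Module.finrank ℝ V),
    (ContinuousAlternatingMap.apply ℝ V ℝ fun k => Module.finBasis ℝ V (I k)).smulRight
      (contract p (h ▸ w : V [⋀^Fin (q + p)]→L[ℝ] ℝ) (fun k => raisedBasis g (I k)))

@[simp]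
theorem hodgeStarCLM_apply (g : LinearMap.BilinForm ℝ V) {m p q : ℕ} (w : V [⋀^Fin m]→L[ℝ] ℝ)
    (h : m = q + p) (α : V [⋀^Fin p]→L[ℝ] ℝ) :
    hodgeStarCLM g w h α = hodgeStar g w h α := by
  simp [hodgeStarCLM, hodgeStar]

/-- The Hodge operator exchanges exterior and interior products:
`g(u, ·) ∧ *α = (-1)^{p-1} * (i_u α)` on `p`-forms. -/
theorem wedge_hodgeStar {g : LinearMap.BilinForm ℝ V} (hg : ∀ u v, g u v = g v u)
    (hnd : g.Nondegenerate) {m p q : ℕ} (hm : Module.finrank ℝ V = m) (w : V [⋀^Fin m]→L[ℝ] ℝ)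
    (h : m = q + (p + 1)) (h' : m = q + 1 + p) (u : V) (α : V [⋀^Fin (p + 1)]→L[ℝ] ℝ) :
    wedge (flat g u) (hodgeStar g w h α) = (-1 : ℝ) ^ p • hodgeStar g w h' (α.curryLeft u) := by
  obtain ⟨m, rfl⟩ : ∃ k, m = k + 1 := ⟨q + p, h⟩
  rw [hodgeStar_eq, hodgeStar_eq, ← wedgeCLM_apply, map_smul, wedgeCLM_apply,
    wedge_fullContract (isReproducing_raisedBasis hg hnd) u h h' (by omega),
    eq_zero_of_finrank_lt (by omega) (wedge (flat g u) w), ← fullContractBilin_apply _ _ _ 0,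
    map_zero, LinearMap.zero_apply, sub_zero, Nat.factorial_succ]
  have h1 : ((p ! : ℕ) : ℝ) ≠ 0 := by positivity
  have h2 : ((p : ℝ) + 1) ≠ 0 := by positivity
  simp only [smul_smul]
  congr 1
  push_cast
  field_simp

theorem hodgeStar_injective {g : LinearMap.BilinForm ℝ V} (hg : ∀ u v, g u v = g v u)
    (hnd : g.Nondegenerate) {m p q : ℕ} (hm : Module.finrank ℝ V = m) {w : V [⋀^Fin m]→L[ℝ] ℝ}
    (hw : w ≠ 0) (h : m = q + p) : Function.Injective (hodgeStar (p := p) (q := q) g w h) := by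
  have key : ∀ α, hodgeStarCLM g w h α = 0 → α = 0 := by
    induction p generalizing q with
    | zero =>
      intro α hα
      obtain rfl : m = q := h
      rw [hodgeStarCLM_apply, hodgeStar_eq, fullContract_zero_deg, Nat.factorial_zero,
        Nat.cast_one, inv_one, one_smul, smul_eq_zero, or_iff_left hw] at hα
      ext v
      rw [Subsingleton.elim v ![], hα]
      rfl
    | succ p ih =>
      intro α hα
      refine curryLeft_ext fun u => ih (q := q + 1) (by omega) _ ?_
      have h1 := wedge_hodgeStar hg hnd hm w h (by omega) u α
      rw [← hodgeStarCLM_apply, hα, ← wedgeCLM_apply, map_zero] at h1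
      rw [hodgeStarCLM_apply]
      exact (smul_eq_zero_iff_right (pow_ne_zero _ (by norm_num))).1 h1.symm
  intro α α' hαα
  rw [← sub_eq_zero]
  refine key _ ?_
  rw [map_sub, hodgeStarCLM_apply, hodgeStarCLM_apply, hαα, sub_self]

theorem hodgeStarInv_hodgeStar {g : LinearMap.BilinForm ℝ V} (hg : ∀ u v, g u v = g v u)
    (hnd : g.Nondegenerate) {m p q : ℕ} (hm : Module.finrank ℝ V = m) {w : V [⋀^Fin m]→L[ℝ] ℝ}
    (hw : w ≠ 0) (h : m = q + p) (α : V [⋀^Fin p]→L[ℝ] ℝ) :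
    hodgeStarInv g w h (hodgeStar g w h α) = α :=
  Function.leftInverse_invFun (hodgeStar_injective hg hnd hm hw h) α

/-- If `i_u α = 0`, where `g(u, u) ≠ 0`, then the dual of `α` vanishes on the orthogonal of `u`. -/
theorem hodgeStar_comp_eq_zero {g : LinearMap.BilinForm ℝ V} (hg : ∀ u v, g u v = g v u)
    (hnd : g.Nondegenerate) {m p q : ℕ} (hm : Module.finrank ℝ V = m) (w : V [⋀^Fin m]→L[ℝ] ℝ)
    (h : m = q + (p + 1)) {u : V} (hu : g u u ≠ 0) {α : V [⋀^Fin (p + 1)]→L[ℝ] ℝ}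
    (hα : α.curryLeft u = 0) {W : Type*} [NormedAddCommGroup W] [NormedSpace ℝ W]
    (j : W →L[ℝ] V) (hj : ∀ x, g u (j x) = 0) :
    (hodgeStar g w h α).compContinuousLinearMap j = 0 := by
  have h1 : wedge (flat g u) (hodgeStar g w h α) = 0 := by
    rw [wedge_hodgeStar hg hnd hm w h (by omega), hα, ← hodgeStarCLM_apply, map_zero, smul_zero]
  have h2 := curryLeft_wedge (flat g u) (hodgeStar g w h α) u
  rw [h1, ContinuousAlternatingMap.curryLeft_zero, _root_.zero_apply, eq_comm, sub_eq_zero] at h2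
  have h3 : (wedgeInterior (flat g u) u (hodgeStar g w h α)).compContinuousLinearMap j = 0 := by
    cases q with
    | zero => rfl
    | succ q =>
      rw [wedgeInterior, wedge_compContinuousLinearMap]
      have : (flat g u).comp j = 0 := by ext x; exact hj x
      rw [this]
      ext v
      simp [wedge_apply]
  rw [← h2, ← compContinuousLinearMapCLM_apply, map_smul, smul_eq_zero] at h3
  exact h3.resolve_left hu

/-- The Hodge operator of a nondegenerate hyperplane `W` orthogonal to `e`, with volume form
`(i_e w)|_W`, in terms of that of the ambient space. -/
theorem curryLeft_hodgeStar_comp {g : LinearMap.BilinForm ℝ V} (hg : ∀ u v, g u v = g v u)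
    (hnd : g.Nondegenerate) {W : Type*} [NormedAddCommGroup W] [NormedSpace ℝ W]
    [FiniteDimensional ℝ W] {gW : LinearMap.BilinForm ℝ W} (hndW : gW.Nondegenerate)
    (j : W →L[ℝ] V) (hj : ∀ x y, gW x y = g (j x) (j y)) {e : V}
    (hje : ∀ x, g e (j x) = 0) (hdec : ∀ v, ∃ x, v = j x + (g e v / g e e) • e)
    {m p q : ℕ} (h : m + 1 = q + 1 + p) (h' : m = q + p) (w : V [⋀^Fin (m + 1)]→L[ℝ] ℝ)
    (α : V [⋀^Fin p]→L[ℝ] ℝ) :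
    ((hodgeStar g w h α).curryLeft e).compContinuousLinearMap j =
      (-1 : ℝ) ^ p • hodgeStar gW ((w.curryLeft e).compContinuousLinearMap j) h'
        (α.compContinuousLinearMap j) := by
  have hgW : ∀ x y, gW x y = gW y x := fun x y => by rw [hj, hj, hg]
  have hW := isReproducing_raisedBasis hgW hndW
  have hR : IsReproducing g (fun o : Option _ => o.elim e fun i => j (Module.finBasis ℝ W i))
      (fun o : Option _ => o.elim ((g e e)⁻¹ • e) fun i => j (raisedBasis gW i)) := by
    intro v
    obtain ⟨x, hx⟩ := hdec v
    rw [Fintype.sum_option]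
    simp only [Option.elim_none, Option.elim_some]
    conv_rhs => rw [hx, ← hW x, map_sum]
    rw [add_comm]
    congr 1
    · refine Finset.sum_congr rfl fun i _ => ?_
      rw [map_smul, hj]
      conv_lhs => rw [hx]
      rw [map_add, LinearMap.add_apply, map_smul, LinearMap.smul_apply, hje, smul_zero, add_zero]
    · rw [map_smul, smul_eq_mul, hg v e, div_eq_inv_mul]
  have hz : ∀ (v : Fin m → V) (i : Fin m), v i = (g e e)⁻¹ • e → w.curryLeft e v = 0 := by
    intro v i hi
    have : v = Function.update v i ((g e e)⁻¹ • e) := by rw [← hi, Function.update_eq_self]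
    rw [this, ContinuousAlternatingMap.map_update_smul, curryLeft_apply_apply,
      w.map_eq_zero_of_eq _ (i := 0) (j := i.succ), smul_zero]
    · simp
    · exact (Fin.succ_ne_zero i).symm
  rw [hodgeStar_eq, hodgeStar_eq, ← interior_apply, map_smul, interior_apply,
    curryLeft_fullContract _ _ h h', fullContract_eq hg (isReproducing_raisedBasis hg hnd) hR,
    ← compContinuousLinearMapCLM_apply, map_smul, map_smul, compContinuousLinearMapCLM_apply,
    fullContract_comp _ _ j e ((g e e)⁻¹ • e) h' _ hz, smul_comm]

end Hodge

/-! ### The ambient codifferential -/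

section Ambient

variable {n : ℕ} {ε : ℝ}

theorem metric_apply (u v : Ambient n) :
    metric n ε u v = ∑ A, signs n ε A * u A * v A := by
  simp only [metric, Matrix.toBilin'_apply', Matrix.mulVec_diagonal, dotProduct]
  exact Finset.sum_congr rfl fun A _ => by ring

theorem metric_comm (u v : Ambient n) : metric n ε u v = metric n ε v u := by
  simp only [metric_apply]
  exact Finset.sum_congr rfl fun A _ => by ring

theorem signs_mul_self (hε : ε = 1 ∨ ε = -1) (A : Fin (n + 1)) :
    signs n ε A * signs n ε A = 1 := by
  rcases hε with rfl | rfl <;> · simp only [signs]; split_ifs <;> norm_num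

theorem metric_single_right (u : Ambient n) (A : Fin (n + 1)) :
    metric n ε u (Pi.single A 1) = signs n ε A * u A := by
  simp [metric_apply, Pi.single_apply]

theorem metric_nondegenerate (hε : ε = 1 ∨ ε = -1) : (metric n ε).Nondegenerate := by
  refine LinearMap.BilinForm.nondegenerate_toBilin'_of_det_ne_zero' _ ?_
  rw [Matrix.det_diagonal]
  refine Finset.prod_ne_zero_iff.2 fun A _ h => ?_
  simpa [h] using signs_mul_self hε A

theorem vol_ne_zero : vol n ≠ 0 := by
  intro h
  have h1 : (Pi.basisFun ℝ (Fin (n + 1))).det (Pi.basisFun ℝ (Fin (n + 1))) = 0 :=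
    congrArg (fun w => w (Pi.basisFun ℝ (Fin (n + 1)))) h
  rw [Module.Basis.det_self] at h1
  exact one_ne_zero h1

theorem sum_signs_metric_smul (hε : ε = 1 ∨ ε = -1) (u : Ambient n) :
    ∑ A, (signs n ε A * metric n ε u (Pi.single A 1)) • (Pi.single A 1 : Ambient n) = u := by
  simp only [metric_single_right, ← mul_assoc, signs_mul_self hε, one_mul]
  exact (pi_eq_sum_univ' u).symm

/-- The trace `∑ η^{AA} i_A L_A` of a linear map `L` with values in alternating forms. Applied to
the derivative of a form, it gives its divergence. -/
def divergence (ε : ℝ) {p : ℕ} (L : Ambient n →L[ℝ] Ambient n [⋀^Fin (p + 1)]→L[ℝ] ℝ) :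
    Ambient n [⋀^Fin p]→L[ℝ] ℝ :=
  ∑ A, signs n ε A • (L (Pi.single A 1)).curryLeft (Pi.single A 1)

/-- `divergence` as a continuous linear map. -/
def divergenceCLM (n : ℕ) (ε : ℝ) (p : ℕ) :
    (Ambient n →L[ℝ] Ambient n [⋀^Fin (p + 1)]→L[ℝ] ℝ) →L[ℝ] Ambient n [⋀^Fin p]→L[ℝ] ℝ :=
  ∑ A, signs n ε A • (interior p (Pi.single A 1)).comp
    (ContinuousLinearMap.apply ℝ (Ambient n [⋀^Fin (p + 1)]→L[ℝ] ℝ) (Pi.single A 1))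

@[simp]
theorem divergenceCLM_apply {p : ℕ} (L : Ambient n →L[ℝ] Ambient n [⋀^Fin (p + 1)]→L[ℝ] ℝ) :
    divergenceCLM n ε p L = divergence ε L := by
  simp [divergenceCLM, divergence]

/-- Antisymmetrization in terms of the components of the first argument. -/
theorem alternatizeUncurryFin_eq_sum (hε : ε = 1 ∨ ε = -1) {p : ℕ}
    (L : Ambient n →L[ℝ] Ambient n [⋀^Fin p]→L[ℝ] ℝ) :
    alternatizeUncurryFin L =
      ∑ A, signs n ε A • wedge (flat (metric n ε) (Pi.single A 1)) (L (Pi.single A 1)) := by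
  have h : L = ∑ A, signs n ε A • (flat (metric n ε) (Pi.single A 1)).smulRight
      (L (Pi.single A 1)) := by
    ext1 u
    conv_lhs => rw [← sum_signs_metric_smul hε u, map_sum]
    rw [_root_.sum_apply]
    refine Finset.sum_congr rfl fun A _ => ?_
    rw [map_smul, _root_.smul_apply, ContinuousLinearMap.smulRight_apply, flat_apply,
      metric_comm, smul_smul]
  conv_lhs => rw [h]
  rw [← alternatizeUncurryFinCLM_apply, map_sum]
  simp only [map_smul]
  rfl

/-- Exterior derivative of the Hodge dual of a form, in terms of its divergence. -/
theorem alternatizeUncurryFin_hodgeStar (hε : ε = 1 ∨ ε = -1) {p q : ℕ}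
    (h : n + 1 = q + (p + 1)) (h' : n + 1 = q + 1 + p)
    (L : Ambient n →L[ℝ] Ambient n [⋀^Fin (p + 1)]→L[ℝ] ℝ) :
    alternatizeUncurryFin ((hodgeStarCLM (metric n ε) (vol n) h).comp L) =
      (-1 : ℝ) ^ p • hodgeStar (metric n ε) (vol n) h' (divergence ε L) := by
  rw [alternatizeUncurryFin_eq_sum hε, divergence, ← hodgeStarCLM_apply, map_sum,
    Finset.smul_sum]
  refine Finset.sum_congr rfl fun A _ => ?_
  rw [ContinuousLinearMap.comp_apply, hodgeStarCLM_apply,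
    wedge_hodgeStar metric_comm (metric_nondegenerate hε) (by simp) _ h h', map_smul, smul_comm,
    hodgeStarCLM_apply]

theorem extDeriv_starA (hε : ε = 1 ∨ ε = -1) {p q : ℕ} (h : n + 1 = q + (p + 1))
    (h' : n + 1 = q + 1 + p) {α : AForm n (p + 1)} {y : Ambient n} (hα : DifferentiableAt ℝ α y) :
    extDeriv (starA ε h α) y =
      (-1 : ℝ) ^ p • hodgeStar (metric n ε) (vol n) h' (divergence ε (fderiv ℝ α y)) := by
  have h1 : starA ε h α = fun z => hodgeStarCLM (metric n ε) (vol n) h (α z) := by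
    funext z
    rw [hodgeStarCLM_apply]
    rfl
  rw [← alternatizeUncurryFin_hodgeStar hε h h', extDeriv, h1]
  congr 1
  exact ((hodgeStarCLM (metric n ε) (vol n) h).hasFDerivAt.comp y hα.hasFDerivAt).fderiv

/-- In cartesian coordinates the codifferential is minus the divergence. -/
theorem codiffSucc_eq_divergence (hε : ε = 1 ∨ ε = -1) {p : ℕ} {α : AForm n (p + 1)}
    {y : Ambient n} (hα : DifferentiableAt ℝ α y) :
    codiffSucc ε α y = (-1 : ℝ) • divergence ε (fderiv ℝ α y) := by
  unfold codiffSucc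
  split_ifs with hp
  · simp only
    rw [starInvA, extDeriv_starA hε _ (by omega) hα]
    rw [← hodgeStarCLM_apply, ← map_smul, hodgeStarCLM_apply,
      hodgeStarInv_hodgeStar metric_comm (metric_nondegenerate hε) (by simp) vol_ne_zero, smul_smul,
      ← pow_add, Odd.neg_one_pow ⟨p, by ring⟩]
  · rw [divergence]
    simp only [fun A => eq_zero_of_finrank_lt (V := Ambient n) (by simp; omega)
      (fderiv ℝ α y (Pi.single A 1))]
    simp

end Ambient

/-! ### Transverse forms -/

section Transverse

variable {V : Type*} [NormedAddCommGroup V] [NormedSpace ℝ V]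

/-- The form `w` vanishes as soon as one of its arguments is `u`. For forms of positive degree this
means `i_u w = 0`; for forms of degree zero this is no condition. -/
def Transverse (u : V) {q : ℕ} (w : V [⋀^Fin q]→L[ℝ] ℝ) : Prop :=
  ∀ (v : Fin q → V) (i : Fin q), v i = u → w v = 0

theorem transverse_zero_deg (u : V) (w : V [⋀^Fin 0]→L[ℝ] ℝ) : Transverse u w :=
  fun _ i => i.elim0

theorem transverse_iff {u : V} {q : ℕ} {w : V [⋀^Fin (q + 1)]→L[ℝ] ℝ} :
    Transverse u w ↔ w.curryLeft u = 0 := by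
  constructor
  · intro h
    ext v
    exact h _ 0 rfl
  · intro h v i hv
    rw [← Fin.insertNth_self_removeNth i v, hv, ContinuousAlternatingMap.map_insertNth,
      ← curryLeft_apply_apply, h]
    simp

theorem transverse_smul_iff {c : ℝ} (hc : c ≠ 0) {u : V} {q : ℕ} {w : V [⋀^Fin q]→L[ℝ] ℝ} :
    Transverse (c • u) w ↔ Transverse u w := by
  cases q with
  | zero => exact iff_of_true (transverse_zero_deg _ _) (transverse_zero_deg _ _)
  | succ q => rw [transverse_iff, transverse_iff, map_smul, smul_eq_zero, or_iff_right hc]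

theorem Transverse.wedgeInterior_eq_zero {u : V} {q : ℕ} {w : V [⋀^Fin q]→L[ℝ] ℝ}
    (h : Transverse u w) (θ : V →L[ℝ] ℝ) : wedgeInterior θ u w = 0 := by
  cases q with
  | zero => rfl
  | succ q =>
    rw [wedgeInterior, transverse_iff.1 h, ← wedgeCLM_apply, map_zero]

theorem Transverse.curryLeft_wedge {u : V} {q : ℕ} {w : V [⋀^Fin q]→L[ℝ] ℝ}
    (h : Transverse u w) (θ : V →L[ℝ] ℝ) : (wedge θ w).curryLeft u = θ u • w := by
  rw [DS.curryLeft_wedge, h.wedgeInterior_eq_zero, sub_zero]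

end Transverse

/-! ### The cone -/

section Cone

variable {n : ℕ} {ε : ℝ}

theorem metric_self_ne_zero {y : Ambient n} (hy : y ∈ cone n ε) : metric n ε y y ≠ 0 := by
  intro h
  simp [cone, h] at hy

/-- The bilinear form `η` as a continuous bilinear map. -/
def flatCLM (n : ℕ) (ε : ℝ) : Ambient n →L[ℝ] Ambient n →L[ℝ] ℝ :=
  LinearMap.toContinuousLinearMap
    ((LinearMap.toContinuousLinearMap (𝕜 := ℝ) (E := Ambient n) (F' := ℝ)).toLinearMap ∘ₗ
      metric n ε)

@[simp]
theorem flatCLM_apply (u : Ambient n) : flatCLM n ε u = flat (metric n ε) u := rfl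

theorem hasFDerivAt_metric_self (y : Ambient n) :
    HasFDerivAt (fun z => metric n ε z z) ((2 : ℝ) • flat (metric n ε) y) y := by
  have h := (flatCLM n ε).hasFDerivAt (x := y) |>.clm_apply (hasFDerivAt_id y)
  refine h.congr_fderiv ?_
  ext v
  simp [metric_comm v y, two_mul]

theorem contDiff_metric_self : ContDiff ℝ ∞ fun y : Ambient n => metric n ε y y :=
  ((flatCLM n ε).contDiff.clm_apply contDiff_id : ContDiff ℝ ∞ fun y => flatCLM n ε y (id y))

theorem isOpen_cone : IsOpen (cone n ε) :=
  isOpen_lt continuous_const (continuous_const.mul contDiff_metric_self.continuous)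

theorem smul_mem_cone {y : Ambient n} (hy : y ∈ cone n ε) {c : ℝ} (hc : 0 < c) :
    c • y ∈ cone n ε := by
  simp only [cone, Set.mem_ofPred_eq, map_smul, LinearMap.smul_apply, smul_eq_mul] at hy ⊢
  have : 0 < c * c * (-ε * metric n ε y y) := by positivity
  linarith

theorem contDiffOn_inv_metric_self :
    ContDiffOn ℝ ∞ (fun y : Ambient n => (metric n ε y y)⁻¹) (cone n ε) :=
  contDiff_metric_self.contDiffOn.inv fun _ hy => metric_self_ne_zero hy

theorem abs_metric_self (hε : ε = 1 ∨ ε = -1) {y : Ambient n} (hy : y ∈ cone n ε) :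
    |metric n ε y y| = -ε * metric n ε y y := by
  rw [cone, Set.mem_ofPred_eq] at hy
  rcases hε with rfl | rfl
  · rw [abs_of_neg (by linarith)]; ring
  · rw [abs_of_pos (by linarith)]; ring

theorem hFun_pos {y : Ambient n} (hy : y ∈ cone n ε) : 0 < hFun n ε y :=
  inv_pos.2 (Real.sqrt_pos.2 (abs_pos.2 (metric_self_ne_zero hy)))

theorem neg_mul_hFun_sq (hε : ε = 1 ∨ ε = -1) {y : Ambient n} (hy : y ∈ cone n ε) :
    -ε * hFun n ε y ^ 2 = (metric n ε y y)⁻¹ := by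
  have hN := metric_self_ne_zero hy
  rw [hFun, inv_pow, Real.sq_sqrt (abs_nonneg _), abs_metric_self hε hy]
  rcases hε with rfl | rfl <;> field_simp

/-- `h e^n = h d(h⁻¹) = y_A dy^A / y²` on the cone. -/
theorem hFun_smul_normalForm (hε : ε = 1 ∨ ε = -1) {y : Ambient n} (hy : y ∈ cone n ε) :
    hFun n ε y • normalForm n ε y = (metric n ε y y)⁻¹ • flat (metric n ε) y := by
  have h1 : (fun z => (hFun n ε z)⁻¹) =ᶠ[nhds y] fun z => Real.sqrt (-ε * metric n ε z z) := by
    filter_upwards [isOpen_cone.mem_nhds hy] with z hz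
    rw [hFun, inv_inv, abs_metric_self hε hz]
  have h2 := ((hasFDerivAt_metric_self (ε := ε) y).const_mul (-ε)).sqrt
    (by rw [← abs_metric_self hε hy]; exact abs_ne_zero.2 (metric_self_ne_zero hy))
  have h3 : hFun n ε y = (Real.sqrt (-ε * metric n ε y y))⁻¹ := by
    rw [hFun, abs_metric_self hε hy]
  rw [normalForm, h1.fderiv_eq, h2.fderiv, ← neg_mul_hFun_sq hε hy, h3]
  simp only [smul_smul]
  congr 1
  ring

theorem transverse_normalVec_iff {y : Ambient n} (hy : y ∈ cone n ε) {q : ℕ}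
    {w : Ambient n [⋀^Fin q]→L[ℝ] ℝ} : Transverse (normalVec n ε y) w ↔ Transverse y w :=
  transverse_smul_iff (hFun_pos hy).ne'

/-- Homogeneity of degree `r` on the cone of a map with values in a fixed vector space. For a
form of degree `b`, this means that it is `(r + b)`-homogeneous as a form. -/
def HomogeneousOn (n : ℕ) (ε r : ℝ) {E : Type*} [SMul ℝ E] (f : Ambient n → E) : Prop :=
  ∀ y ∈ cone n ε, ∀ c : ℝ, 0 < c → f (c • y) = c ^ r • f y

section HomogeneousOn

variable {E F : Type*} [NormedAddCommGroup E] [NormedSpace ℝ E] [NormedAddCommGroup F]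
  [NormedSpace ℝ F] {r : ℝ} {f : Ambient n → E}

theorem HomogeneousOn.clm (hf : HomogeneousOn n ε r f) (L : E →L[ℝ] F) :
    HomogeneousOn n ε r fun y => L (f y) := fun y hy c hc => by
  simp only [hf y hy c hc, map_smul]

theorem HomogeneousOn.congr (hf : HomogeneousOn n ε r f) {g : Ambient n → E}
    (h : ∀ y ∈ cone n ε, g y = f y) : HomogeneousOn n ε r g := fun y hy c hc => by
  rw [h _ (smul_mem_cone hy hc), h y hy, hf y hy c hc]

theorem HomogeneousOn.add (hf : HomogeneousOn n ε r f) {g : Ambient n → E}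
    (hg : HomogeneousOn n ε r g) : HomogeneousOn n ε r fun y => f y + g y := fun y hy c hc => by
  simp only [hf y hy c hc, hg y hy c hc, smul_add]

theorem HomogeneousOn.const_smul (hf : HomogeneousOn n ε r f) (a : ℝ) :
    HomogeneousOn n ε r fun y => a • f y := fun y hy c hc => by
  simp only [hf y hy c hc, smul_comm a]

theorem homogeneousOn_inv_metric_self :
    HomogeneousOn n ε (-2) fun y => (metric n ε y y)⁻¹ := fun y _ c hc => by
  simp only [map_smul, LinearMap.smul_apply, smul_eq_mul]
  rw [Real.rpow_neg hc.le, Real.rpow_ofNat, mul_inv, mul_inv, sq, mul_inv, mul_assoc]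

theorem HomogeneousOn.smul {t : ℝ} {g : Ambient n → ℝ} (hg : HomogeneousOn n ε t g)
    (hf : HomogeneousOn n ε r f) : HomogeneousOn n ε (t + r) fun y => g y • f y :=
  fun y hy c hc => by
    simp only [hf y hy c hc, hg y hy c hc, Real.rpow_add hc, smul_smul, smul_eq_mul]
    congr 1
    ring

theorem HomogeneousOn.fderiv (hf : HomogeneousOn n ε r f) :
    HomogeneousOn n ε (r - 1) (fderiv ℝ f) := fun y hy c hc => by
  have h1 : (fun z => f (c • z)) =ᶠ[nhds y] fun z => c ^ r • f z := by
    filter_upwards [isOpen_cone.mem_nhds hy] with z hz using hf z hz c hc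
  have h2 := h1.fderiv_eq (𝕜 := ℝ)
  have h3 : _root_.fderiv ℝ (fun z => c ^ r • f z) y = c ^ r • _root_.fderiv ℝ f y :=
    congrFun (fderiv_const_smul_field (𝕜 := ℝ) (f := f) (c ^ r)) y
  rw [fderiv_comp_smul, h3] at h2
  rw [Real.rpow_sub_one hc.ne', div_eq_inv_mul, mul_smul, ← h2, smul_smul, inv_mul_cancel₀ hc.ne',
    one_smul]

/-- Euler's identity. -/
theorem HomogeneousOn.fderiv_apply_self (hf : HomogeneousOn n ε r f) {y : Ambient n}
    (hy : y ∈ cone n ε) (hd : DifferentiableAt ℝ f y) : _root_.fderiv ℝ f y y = r • f y := by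
  have h1 : HasDerivAt (fun c : ℝ => f (c • y)) (_root_.fderiv ℝ f y y) 1 := by
    have h2 : HasDerivAt (fun c : ℝ => c • y) y 1 := by
      simpa using (hasDerivAt_id (1 : ℝ)).smul_const y
    have h3 : HasFDerivAt f (_root_.fderiv ℝ f y) ((1 : ℝ) • y) := by
      rw [one_smul]; exact hd.hasFDerivAt
    exact h3.comp_hasDerivAt 1 h2
  have h2 : HasDerivAt (fun c : ℝ => c ^ r • f y) (r • f y) 1 := by
    simpa using (Real.hasDerivAt_rpow_const (x := 1) (p := r) (Or.inl one_ne_zero)).smul_const (f y)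
  refine h1.unique (h2.congr_of_eventuallyEq ?_)
  filter_upwards [lt_mem_nhds (zero_lt_one (α := ℝ))] with c hc using hf y hy c hc

end HomogeneousOn

/-- Transversality and homogeneity of a form in terms of its coefficients. -/
theorem isTransverseHomogeneous_iff {b : ℕ} {s : ℝ} {α : AForm n b} :
    IsTransverseHomogeneous ε s α ↔ ContDiffOn ℝ ∞ α (cone n ε) ∧
      (∀ y ∈ cone n ε, Transverse y (α y)) ∧ HomogeneousOn n ε (s - b) α := by
  have key : ∀ (y : Ambient n) (c : ℝ), (α (c • y)).compContinuousLinearMap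
      (c • ContinuousLinearMap.id ℝ (Ambient n)) = c ^ b • α (c • y) := by
    intro y c
    ext v
    have := (α (c • y)).map_smul_univ (fun _ => c) v
    rw [Finset.prod_const, Finset.card_univ, Fintype.card_fin] at this
    exact this
  constructor
  · intro h
    refine ⟨h.smooth, fun y hy => (transverse_normalVec_iff hy).1 (h.transverse y hy), ?_⟩
    intro y hy c hc
    rw [Real.rpow_sub hc, Real.rpow_natCast, div_eq_inv_mul, mul_smul, ← h.homogeneous y hy c hc,
      key, smul_smul, inv_mul_cancel₀ (pow_ne_zero _ hc.ne'), one_smul]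
  · rintro ⟨h1, h2, h3⟩
    refine ⟨h1, fun y hy => (transverse_normalVec_iff hy).2 (h2 y hy), fun y hy c hc => ?_⟩
    rw [key, h3 y hy c hc, Real.rpow_sub hc, Real.rpow_natCast, smul_smul,
      mul_div_cancel₀ _ (pow_ne_zero _ hc.ne')]

end Cone

/-! ### The contraction with the dilation field -/

theorem hasFDerivAt_clm_comp {E F G : Type*} [NormedAddCommGroup E] [NormedSpace ℝ E]
    [NormedAddCommGroup F] [NormedSpace ℝ F] [NormedAddCommGroup G] [NormedSpace ℝ G]
    (L : F →L[ℝ] G) {f : E → F} {y : E} (hf : DifferentiableAt ℝ f y) :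
    HasFDerivAt (fun z => L (f z)) (L.comp (fderiv ℝ f y)) y :=
  L.hasFDerivAt.comp y hf.hasFDerivAt

theorem contDiffOn_clm_comp {E F G : Type*} [NormedAddCommGroup E] [NormedSpace ℝ E]
    [NormedAddCommGroup F] [NormedSpace ℝ F] [NormedAddCommGroup G] [NormedSpace ℝ G]
    (L : F →L[ℝ] G) {f : E → F} {t : Set E} (hf : ContDiffOn ℝ ∞ f t) :
    ContDiffOn ℝ ∞ (fun z => L (f z)) t :=
  L.contDiff.comp_contDiffOn hf

section Euler

variable {n : ℕ} {ε : ℝ}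

theorem hasFDerivAt_curryLeft_self {q : ℕ} {α : AForm n (q + 1)} {y : Ambient n}
    (hα : DifferentiableAt ℝ α y) :
    HasFDerivAt (fun z => (α z).curryLeft z)
      ((α y).curryLeft + (interior q y).comp (fderiv ℝ α y)) y := by
  have h1 : HasFDerivAt (fun z => (α z).curryLeft)
      ((curryLeftLI (𝕜 := ℝ) (E := Ambient n) (F := ℝ) (n := q)).toContinuousLinearMap.comp
        (fderiv ℝ α y)) y :=
    hasFDerivAt_clm_comp (F := Ambient n [⋀^Fin (q + 1)]→L[ℝ] ℝ)
      (G := Ambient n →L[ℝ] Ambient n [⋀^Fin q]→L[ℝ] ℝ) curryLeftLI.toContinuousLinearMap hα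
  refine (h1.clm_apply (hasFDerivAt_id y)).congr_fderiv ?_
  ext1 v
  simp

/-- Cartan's formula `i_D dα + d i_D α = ∂_D α + (deg α) α` for the dilation field `D`. -/
theorem extDeriv_curryLeft_self {q : ℕ} {α : AForm n (q + 1)} {y : Ambient n}
    (hα : DifferentiableAt ℝ α y) :
    extDeriv (fun z => (α z).curryLeft z) y =
      fderiv ℝ α y y + (q + 1 : ℝ) • α y - (extDeriv α y).curryLeft y := by
  rw [extDeriv, (hasFDerivAt_curryLeft_self hα).fderiv, extDeriv, curryLeft_alternatizeUncurryFin,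
    ContinuousAlternatingMap.alternatizeUncurryFin_add,
    ContinuousAlternatingMap.alternatizeUncurryFin_curryLeft, ← Nat.cast_smul_eq_nsmul ℝ]
  push_cast
  abel

/-- The codifferential anticommutes with `i_D`. -/
theorem curryLeft_divergence {p : ℕ} {α : AForm n (p + 2)} {y : Ambient n}
    (hα : DifferentiableAt ℝ α y) :
    (divergence ε (fderiv ℝ α y)).curryLeft y =
      (-1 : ℝ) • divergence ε (fderiv ℝ (fun z => (α z).curryLeft z) y) := by
  rw [(hasFDerivAt_curryLeft_self hα).fderiv, divergence, divergence, ← interior_apply, map_sum,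
    Finset.smul_sum]
  refine Finset.sum_congr rfl fun A _ => ?_
  rw [map_smul, interior_apply, curryLeft_curryLeft_swap, _root_.add_apply, curryLeft_add,
    _root_.add_apply, curryLeft_same, zero_add, ContinuousLinearMap.comp_apply, interior_apply]
  module

theorem curryLeft_self_eventuallyEq_zero {q : ℕ} {α : AForm n (q + 1)}
    (hα : ∀ y ∈ cone n ε, Transverse y (α y)) {y : Ambient n} (hy : y ∈ cone n ε) :
    (fun z => (α z).curryLeft z) =ᶠ[nhds y] fun _ => 0 := by
  filter_upwards [isOpen_cone.mem_nhds hy] with z hz using transverse_iff.1 (hα z hz)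

end Euler

/-! ### Transverse homogeneous forms -/

namespace IsTransverseHomogeneous

variable {n b : ℕ} {ε s : ℝ} {α : AForm n b}

theorem transverse_self (h : IsTransverseHomogeneous ε s α) {y : Ambient n} (hy : y ∈ cone n ε) :
    Transverse y (α y) := (isTransverseHomogeneous_iff.1 h).2.1 y hy

theorem homogeneousOn (h : IsTransverseHomogeneous ε s α) : HomogeneousOn n ε (s - b) α :=
  (isTransverseHomogeneous_iff.1 h).2.2

theorem contDiffAt (h : IsTransverseHomogeneous ε s α) {y : Ambient n} (hy : y ∈ cone n ε) :
    ContDiffAt ℝ ∞ α y := h.smooth.contDiffAt (isOpen_cone.mem_nhds hy)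

theorem differentiableAt (h : IsTransverseHomogeneous ε s α) {y : Ambient n}
    (hy : y ∈ cone n ε) : DifferentiableAt ℝ α y :=
  (h.contDiffAt hy).differentiableAt (by simp)

/-- `i_D dα = s α` for a transverse `s`-homogeneous form. -/
theorem curryLeft_extDeriv (h : IsTransverseHomogeneous ε s α) {y : Ambient n}
    (hy : y ∈ cone n ε) : (extDeriv α y).curryLeft y = s • α y := by
  have hd := h.homogeneousOn.fderiv_apply_self hy (h.differentiableAt hy)
  cases b with
  | zero =>
    rw [extDeriv, curryLeft_alternatizeUncurryFin_zero, hd]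
    simp
  | succ q =>
    have h1 := extDeriv_curryLeft_self (h.differentiableAt hy)
    rw [(curryLeft_self_eventuallyEq_zero (fun z hz => h.transverse_self hz) hy).extDeriv_eq,
      hd] at h1
    have h2 : extDeriv (fun _ : Ambient n => (0 : Ambient n [⋀^Fin q]→L[ℝ] ℝ)) y = 0 := by
      rw [extDeriv, fderiv_fun_const, Pi.zero_apply, ← alternatizeUncurryFinCLM_apply, map_zero]
    rw [h2, eq_comm, sub_eq_zero] at h1
    rw [← h1]
    push_cast
    module

end IsTransverseHomogeneous

section Smoothness

variable {n b : ℕ} {ε : ℝ} {α : AForm n b}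

theorem contDiffOn_fderiv (h : ContDiffOn ℝ ∞ α (cone n ε)) :
    ContDiffOn ℝ ∞ (fderiv ℝ α) (cone n ε) :=
  h.fderiv_of_isOpen isOpen_cone (by simp)

theorem contDiffOn_extDeriv (h : ContDiffOn ℝ ∞ α (cone n ε)) :
    ContDiffOn ℝ ∞ (extDeriv α) (cone n ε) :=
  contDiffOn_clm_comp (F := Ambient n →L[ℝ] Ambient n [⋀^Fin b]→L[ℝ] ℝ)
    (G := Ambient n [⋀^Fin (b + 1)]→L[ℝ] ℝ) (alternatizeUncurryFinCLM ℝ (Ambient n) ℝ)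
    (contDiffOn_fderiv h)

theorem differentiableAt_of_contDiffOn_cone {E : Type*} [NormedAddCommGroup E] [NormedSpace ℝ E]
    {f : Ambient n → E} (h : ContDiffOn ℝ ∞ f (cone n ε)) {y : Ambient n} (hy : y ∈ cone n ε) :
    DifferentiableAt ℝ f y :=
  (h.contDiffAt (isOpen_cone.mem_nhds hy)).differentiableAt (by simp)

theorem codiffSucc_eq_on_cone (hε : ε = 1 ∨ ε = -1) {p : ℕ} {α : AForm n (p + 1)}
    (h : ContDiffOn ℝ ∞ α (cone n ε)) {y : Ambient n} (hy : y ∈ cone n ε) :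
    codiffSucc ε α y = (-1 : ℝ) • divergenceCLM n ε p (fderiv ℝ α y) := by
  rw [codiffSucc_eq_divergence hε (differentiableAt_of_contDiffOn_cone h hy), divergenceCLM_apply]

theorem contDiffOn_codiffSucc (hε : ε = 1 ∨ ε = -1) {p : ℕ} {α : AForm n (p + 1)}
    (h : ContDiffOn ℝ ∞ α (cone n ε)) : ContDiffOn ℝ ∞ (codiffSucc ε α) (cone n ε) :=
  ((contDiffOn_clm_comp (F := Ambient n →L[ℝ] Ambient n [⋀^Fin (p + 1)]→L[ℝ] ℝ)
    (G := Ambient n [⋀^Fin p]→L[ℝ] ℝ) (divergenceCLM n ε p) (contDiffOn_fderiv h)).const_smul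
      (-1 : ℝ)).congr fun _ hy => codiffSucc_eq_on_cone hε h hy

theorem homogeneousOn_extDeriv {r : ℝ} (h : HomogeneousOn n ε r α) :
    HomogeneousOn n ε (r - 1) (extDeriv α) :=
  h.fderiv.clm (E := Ambient n →L[ℝ] Ambient n [⋀^Fin b]→L[ℝ] ℝ)
    (F := Ambient n [⋀^Fin (b + 1)]→L[ℝ] ℝ) (alternatizeUncurryFinCLM ℝ (Ambient n) ℝ)

theorem homogeneousOn_codiffSucc (hε : ε = 1 ∨ ε = -1) {p : ℕ} {α : AForm n (p + 1)}
    (hs : ContDiffOn ℝ ∞ α (cone n ε)) {r : ℝ} (h : HomogeneousOn n ε r α) :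
    HomogeneousOn n ε (r - 1) (codiffSucc ε α) := by
  have h1 := (h.fderiv.clm (E := Ambient n →L[ℝ] Ambient n [⋀^Fin (p + 1)]→L[ℝ] ℝ)
    (F := Ambient n [⋀^Fin p]→L[ℝ] ℝ) (divergenceCLM n ε p)).const_smul (-1)
  exact h1.congr fun y hy => codiffSucc_eq_on_cone hε hs hy

/-- `i_D δα = -δ (i_D α)`. -/
theorem curryLeft_codiffSucc (hε : ε = 1 ∨ ε = -1) {p : ℕ} {α : AForm n (p + 2)} {y : Ambient n}
    (hα : DifferentiableAt ℝ α y) : (codiffSucc ε α y).curryLeft y =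
      divergence ε (fderiv ℝ (fun z => (α z).curryLeft z) y) := by
  rw [codiffSucc_eq_divergence hε hα, curryLeft_smul, _root_.smul_apply, curryLeft_divergence hα]
  module

end Smoothness

/-- The codifferential of a transverse `s`-homogeneous form is transverse and
`(s - 2)`-homogeneous. -/
theorem IsTransverseHomogeneous.codiffSucc {n b : ℕ} {ε s : ℝ} (hε : ε = 1 ∨ ε = -1)
    {α : AForm n (b + 1)} (h : IsTransverseHomogeneous ε s α) :
    IsTransverseHomogeneous ε (s - 2) (DS.codiffSucc ε α) := by
  rw [isTransverseHomogeneous_iff]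
  refine ⟨contDiffOn_codiffSucc hε h.smooth, fun y hy => ?_, ?_⟩
  · cases b with
    | zero => exact transverse_zero_deg _ _
    | succ p =>
      rw [transverse_iff, curryLeft_codiffSucc hε (h.differentiableAt hy),
        (curryLeft_self_eventuallyEq_zero (fun z hz => h.transverse_self hz) hy).fderiv_eq,
        fderiv_fun_const, Pi.zero_apply, ← divergenceCLM_apply, map_zero]
  · have h1 := homogeneousOn_codiffSucc hε h.smooth h.homogeneousOn
    convert h1 using 1
    push_cast
    ring

/-! ### The codifferential of `(y²)⁻¹ y_A dy^A ∧ α` -/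

section Wedge

variable {V : Type*} [NormedAddCommGroup V] [NormedSpace ℝ V]

/-- The exterior product of a linear form and an alternating form as a continuous bilinear map. -/
def wedgeL (V : Type*) [NormedAddCommGroup V] [NormedSpace ℝ V] (q : ℕ) :
    (V →L[ℝ] ℝ) →L[ℝ] V [⋀^Fin q]→L[ℝ] ℝ →L[ℝ] V [⋀^Fin (q + 1)]→L[ℝ] ℝ :=
  (ContinuousLinearMap.compL ℝ (V [⋀^Fin q]→L[ℝ] ℝ) (V →L[ℝ] V [⋀^Fin q]→L[ℝ] ℝ)
    (V [⋀^Fin (q + 1)]→L[ℝ] ℝ) (alternatizeUncurryFinCLM ℝ V ℝ)).comp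
      (ContinuousLinearMap.smulRightL ℝ V (V [⋀^Fin q]→L[ℝ] ℝ))

theorem hasFDerivAt_smul_bilinear {E F G K : Type*} [NormedAddCommGroup E] [NormedSpace ℝ E]
    [NormedAddCommGroup F] [NormedSpace ℝ F] [NormedAddCommGroup G] [NormedSpace ℝ G]
    [NormedAddCommGroup K] [NormedSpace ℝ K] (B : F →L[ℝ] G →L[ℝ] K) (M : E →L[ℝ] F)
    {f : E → G} {f' : E →L[ℝ] G} {c : E → ℝ} {c' : E →L[ℝ] ℝ} {y : E} (hc : HasFDerivAt c c' y)
    (hf : HasFDerivAt f f' y) :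
    ∃ L : E →L[ℝ] K, HasFDerivAt (fun z => c z • B (M z) (f z)) L y ∧ ∀ v, L v =
      c y • (B (M v) (f y) + B (M y) (f' v)) + c' v • B (M y) (f y) := by
  have h1 : HasFDerivAt (fun z => B (M z)) (B.comp M) y := (B.comp M).hasFDerivAt
  refine ⟨_, hc.smul (h1.clm_apply hf), fun v => ?_⟩
  simp [add_comm]

theorem hasFDerivAt_smul_wedge {q : ℕ} (M : V →L[ℝ] V →L[ℝ] ℝ) {α : V → V [⋀^Fin q]→L[ℝ] ℝ}
    {α' : V →L[ℝ] V [⋀^Fin q]→L[ℝ] ℝ} {c : V → ℝ} {c' : V →L[ℝ] ℝ} {y : V}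
    (hc : HasFDerivAt c c' y) (hα : HasFDerivAt α α' y) :
    ∃ L : V →L[ℝ] V [⋀^Fin (q + 1)]→L[ℝ] ℝ,
      HasFDerivAt (fun z => c z • wedge (M z) (α z)) L y ∧ ∀ v, L v =
        c y • (wedge (M v) (α y) + wedge (M y) (α' v)) + c' v • wedge (M y) (α y) :=
  hasFDerivAt_smul_bilinear (F := V →L[ℝ] ℝ) (G := V [⋀^Fin q]→L[ℝ] ℝ)
    (K := V [⋀^Fin (q + 1)]→L[ℝ] ℝ) (wedgeL V q) M hc hα

end Wedge

section Radial

variable {n b : ℕ} {ε s : ℝ}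

/-- The form `(y²)⁻¹ y_A dy^A ∧ α`, equal to `h e^n ∧ α` on the cone. -/
def radialWedge (ε : ℝ) (α : AForm n b) : AForm n (b + 1) := fun y =>
  (metric n ε y y)⁻¹ • wedge (flat (metric n ε) y) (α y)

/-- The form `(y²)⁻¹ y_A dy^A ∧ δα`, equal to zero on functions. -/
def radialWedgeCodiff (ε : ℝ) : {b : ℕ} → AForm n b → AForm n b
  | 0, _ => fun _ => 0
  | _ + 1, α => radialWedge ε (codiffSucc ε α)

theorem hFun_smul_normalWedge (hε : ε = 1 ∨ ε = -1) (α : AForm n b) {y : Ambient n}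
    (hy : y ∈ cone n ε) : hFun n ε y • normalWedge ε α y = radialWedge ε α y := by
  change hFun n ε y • wedge (normalForm n ε y) (α y) = _
  rw [radialWedge, ← wedge_smul_left, ← wedge_smul_left, hFun_smul_normalForm hε hy]

theorem hFun_smul_normalWedgeCodiff (hε : ε = 1 ∨ ε = -1) (α : AForm n b) {y : Ambient n}
    (hy : y ∈ cone n ε) :
    hFun n ε y • normalWedgeCodiff ε α y = radialWedgeCodiff ε α y := by
  cases b with
  | zero => exact smul_zero _
  | succ b => exact hFun_smul_normalWedge hε _ hy

theorem contDiffOn_radialWedge {α : AForm n b} (h : ContDiffOn ℝ ∞ α (cone n ε)) :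
    ContDiffOn ℝ ∞ (radialWedge ε α) (cone n ε) := by
  have h1 : ContDiffOn ℝ ∞ (fun y => wedgeL (Ambient n) b (flatCLM n ε y)) (cone n ε) :=
    contDiffOn_clm_comp (F := Ambient n →L[ℝ] ℝ)
      (G := Ambient n [⋀^Fin b]→L[ℝ] ℝ →L[ℝ] Ambient n [⋀^Fin (b + 1)]→L[ℝ] ℝ) _
      (flatCLM n ε).contDiff.contDiffOn
  exact contDiffOn_inv_metric_self.smul (h1.clm_apply h)

theorem homogeneousOn_radialWedge {α : AForm n b} {r : ℝ} (h : HomogeneousOn n ε r α) :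
    HomogeneousOn n ε (r - 1) (radialWedge ε α) := by
  have h1 : HomogeneousOn n ε (1 + r) fun y => wedge (flat (metric n ε) y) (α y) := by
    intro y hy c hc
    have : flat (metric n ε) (c • y) = c • flat (metric n ε) y := by ext v; simp
    simp only
    rw [h y hy c hc, this, wedge_smul_left, ← wedgeCLM_apply, map_smul, wedgeCLM_apply, smul_smul,
      Real.rpow_add hc, Real.rpow_one]
  have h2 := HomogeneousOn.smul (E := Ambient n [⋀^Fin (b + 1)]→L[ℝ] ℝ)
    homogeneousOn_inv_metric_self h1
  rw [show r - 1 = -2 + (1 + r) by ring]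
  exact h2

theorem Transverse.curryLeft_radialWedge {α : AForm n b} {y : Ambient n} (hy : y ∈ cone n ε)
    (h : Transverse y (α y)) : (radialWedge ε α y).curryLeft y = α y := by
  rw [radialWedge, curryLeft_smul, _root_.smul_apply, h.curryLeft_wedge, flat_apply,
    inv_smul_smul₀ (metric_self_ne_zero hy)]

theorem hasFDerivAt_radialWedge {α : AForm n b} {y : Ambient n} (hy : y ∈ cone n ε)
    (hα : DifferentiableAt ℝ α y) :
    ∃ L : Ambient n →L[ℝ] Ambient n [⋀^Fin (b + 1)]→L[ℝ] ℝ,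
      HasFDerivAt (radialWedge ε α) L y ∧ ∀ v, L v =
      (metric n ε y y)⁻¹ • (wedge (flat (metric n ε) v) (α y) +
        wedge (flat (metric n ε) y) (fderiv ℝ α y v)) -
      (2 * metric n ε y v * (metric n ε y y)⁻¹ ^ 2) • wedge (flat (metric n ε) y) (α y) := by
  have h1 : HasFDerivAt (fun z => (metric n ε z z)⁻¹)
      (-(metric n ε y y ^ 2)⁻¹ • (2 : ℝ) • flat (metric n ε) y) y :=
    HasDerivAt.comp_hasFDerivAt (f := fun z => metric n ε z z) (h₂ := fun t => t⁻¹) y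
      (hasDerivAt_inv (metric_self_ne_zero hy)) (hasFDerivAt_metric_self y)
  obtain ⟨L, hL, hLv⟩ := hasFDerivAt_smul_wedge (flatCLM n ε) h1 hα.hasFDerivAt
  refine ⟨L, hL, fun v => ?_⟩
  rw [hLv]
  simp only [flatCLM_apply, _root_.smul_apply, flat_apply, smul_eq_mul, inv_pow]
  module

/-- `∑ e^A ∧ i_A w = (deg w) w`. -/
theorem sum_wedgeInterior (hε : ε = 1 ∨ ε = -1) (w : Ambient n [⋀^Fin b]→L[ℝ] ℝ) :
    ∑ A, signs n ε A • wedgeInterior (flat (metric n ε) (Pi.single A 1)) (Pi.single A 1) w =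
      (b : ℝ) • w := by
  cases b with
  | zero => simp [wedgeInterior]
  | succ q =>
    simp only [wedgeInterior]
    rw [← alternatizeUncurryFin_eq_sum hε, ContinuousAlternatingMap.alternatizeUncurryFin_curryLeft,
      ← Nat.cast_smul_eq_nsmul ℝ]

/-- The contribution of the derivatives of `α` to the divergence of `y_A dy^A ∧ α`. -/
theorem sum_wedgeInterior_fderiv (hε : ε = 1 ∨ ε = -1) {α : AForm n b} {y : Ambient n}
    (hα : DifferentiableAt ℝ α y) :
    (metric n ε y y)⁻¹ • ∑ A, signs n ε A • wedgeInterior (flat (metric n ε) y) (Pi.single A 1)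
      (fderiv ℝ α y (Pi.single A 1)) = (-1 : ℝ) • radialWedgeCodiff ε α y := by
  cases b with
  | zero => simp [wedgeInterior, radialWedgeCodiff]
  | succ q =>
    simp only [wedgeInterior, radialWedgeCodiff, radialWedge]
    rw [codiffSucc_eq_divergence hε hα, divergence, ← wedgeCLM_apply, map_smul, map_sum]
    simp only [map_smul, wedgeCLM_apply]
    module

/-- The codifferential of `h e^n ∧ α`. The coefficient collects `n + 1 - b` from the trace of the
derivative of `y_A`, `s - b` from Euler's identity for `α`, and `-2` from the derivative of
`(y²)⁻¹`. -/
theorem IsTransverseHomogeneous.codiffSucc_radialWedge (hε : ε = 1 ∨ ε = -1) {α : AForm n b}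
    (h : IsTransverseHomogeneous ε s α) {y : Ambient n} (hy : y ∈ cone n ε) :
    DS.codiffSucc ε (radialWedge ε α) y =
      -((metric n ε y y)⁻¹ * (s + n - 1 - 2 * b)) • α y - radialWedgeCodiff ε α y := by
  have hα := h.differentiableAt hy
  have hN := metric_self_ne_zero hy
  obtain ⟨L, hL, hLv⟩ := hasFDerivAt_radialWedge hy hα
  have hT := (h.transverse_self hy).curryLeft_wedge (flat (metric n ε) y)
  have hE := h.homogeneousOn.fderiv_apply_self hy hα
  rw [codiffSucc_eq_divergence hε hL.differentiableAt, hL.fderiv, divergence]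
  have hA : ∀ A, signs n ε A • (L (Pi.single A 1)).curryLeft (Pi.single A 1) =
      (metric n ε y y)⁻¹ • (α y - signs n ε A •
        wedgeInterior (flat (metric n ε) (Pi.single A 1)) (Pi.single A 1) (α y) +
        (signs n ε A * metric n ε y (Pi.single A 1)) • fderiv ℝ α y (Pi.single A 1) -
        signs n ε A • wedgeInterior (flat (metric n ε) y) (Pi.single A 1)
          (fderiv ℝ α y (Pi.single A 1))) -
      (2 * (metric n ε y y)⁻¹ ^ 2) • (signs n ε A * metric n ε y (Pi.single A 1)) •
        (wedge (flat (metric n ε) y) (α y)).curryLeft (Pi.single A 1) := by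
    intro A
    have h1 : metric n ε (Pi.single A 1) (Pi.single A 1) = signs n ε A := by
      rw [metric_single_right]; simp
    have h2 := signs_mul_self (n := n) hε A
    rw [hLv, ← interior_apply, map_sub, map_smul, map_smul, map_add, interior_apply,
      interior_apply, interior_apply, DS.curryLeft_wedge _ (α y),
      DS.curryLeft_wedge _ (fderiv _ _ _ _), flat_apply, flat_apply, h1]
    linear_combination (norm := module) h2 • ((metric n ε y y)⁻¹ • α y)
  simp only [hA]
  rw [Finset.sum_sub_distrib, ← Finset.smul_sum, ← Finset.smul_sum, Finset.sum_sub_distrib,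
    Finset.sum_add_distrib, Finset.sum_sub_distrib, sum_wedgeInterior hε]
  have e1 : ∀ K : Ambient n →L[ℝ] Ambient n [⋀^Fin b]→L[ℝ] ℝ,
      ∑ A, (signs n ε A * metric n ε y (Pi.single A 1)) • K (Pi.single A 1) = K y := by
    intro K
    conv_rhs => rw [← sum_signs_metric_smul hε y, map_sum]
    simp only [map_smul]
  have e2 := sum_wedgeInterior_fderiv hε hα
  rw [e1, e1, hT, hE, flat_apply, Finset.sum_const, Finset.card_univ, Fintype.card_fin,
    ← Nat.cast_smul_eq_nsmul ℝ, smul_sub _ _ (∑ A, _), e2]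
  have e3 : (2 * (metric n ε y y)⁻¹ ^ 2) • metric n ε y y • α y =
      (2 * (metric n ε y y)⁻¹) • α y := by
    rw [smul_smul]
    congr 1
    field_simp
  rw [e3]
  push_cast
  module

end Radial

/-! ### The Laplace-de Rham operator on the cone -/

section Box

variable {n b : ℕ} {ε s : ℝ}

theorem contDiffOn_box (hε : ε = 1 ∨ ε = -1) {α : AForm n b} (h : ContDiffOn ℝ ∞ α (cone n ε)) :
    ContDiffOn ℝ ∞ (box ε α) (cone n ε) := by
  have h1 := contDiffOn_codiffSucc hε (contDiffOn_extDeriv h)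
  cases b with
  | zero => exact h1.neg
  | succ b => exact ((contDiffOn_extDeriv (contDiffOn_codiffSucc hε h)).add h1).neg

theorem homogeneousOn_box (hε : ε = 1 ∨ ε = -1) {α : AForm n b}
    (hs : ContDiffOn ℝ ∞ α (cone n ε)) {r : ℝ} (h : HomogeneousOn n ε r α) :
    HomogeneousOn n ε (r - 2) (box ε α) := by
  have h1 := homogeneousOn_codiffSucc hε (contDiffOn_extDeriv hs) (homogeneousOn_extDeriv h)
  rw [sub_sub, one_add_one_eq_two] at h1
  cases b with
  | zero =>
    exact (HomogeneousOn.const_smul (E := Ambient n [⋀^Fin 0]→L[ℝ] ℝ) h1 (-1)).congr fun y _ => by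
      simp only [box]
      module
  | succ b =>
    have h2 := homogeneousOn_extDeriv (homogeneousOn_codiffSucc hε hs h)
    rw [sub_sub, one_add_one_eq_two] at h2
    exact (HomogeneousOn.const_smul (E := Ambient n [⋀^Fin (b + 1)]→L[ℝ] ℝ)
      (HomogeneousOn.add (E := Ambient n [⋀^Fin (b + 1)]→L[ℝ] ℝ) h2 h1) (-1)).congr fun y _ => by
      simp only [box]
      module

theorem IsTransverseHomogeneous.curryLeft_box (hε : ε = 1 ∨ ε = -1)
    {α : AForm n (b + 1)} (h : IsTransverseHomogeneous ε s α) {y : Ambient n}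
    (hy : y ∈ cone n ε) : (box ε α y).curryLeft y = (2 : ℝ) • DS.codiffSucc ε α y := by
  have h1 := (h.codiffSucc hε).curryLeft_extDeriv hy
  have h2 := curryLeft_codiffSucc hε (differentiableAt_of_contDiffOn_cone
    (contDiffOn_extDeriv h.smooth) hy)
  have h3 : (fun z => (extDeriv α z).curryLeft z) =ᶠ[nhds y] fun z => s • α z := by
    filter_upwards [isOpen_cone.mem_nhds hy] with z hz using h.curryLeft_extDeriv hz
  have h4 : fderiv ℝ (fun z => s • α z) y = s • fderiv ℝ α y :=
    fderiv_fun_const_smul (h.differentiableAt hy) s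
  have h5 := codiffSucc_eq_divergence hε (h.differentiableAt hy)
  rw [h3.fderiv_eq, h4, ← divergenceCLM_apply, map_smul, divergenceCLM_apply] at h2
  rw [box, ← interior_apply, map_neg, map_add, interior_apply, interior_apply, h1, h2, h5]
  module

/-- The form `□α - η^{nn} h² s (s + n - 1 - 2b) α - 2 h e^n ∧ δα`. -/
theorem IsTransverseHomogeneous.box_sub (hε : ε = 1 ∨ ε = -1) {α : AForm n b}
    (h : IsTransverseHomogeneous ε s α) (c : ℝ) :
    IsTransverseHomogeneous ε (s - 2) fun y => box ε α y -
      ((metric n ε y y)⁻¹ * c) • α y - (2 : ℝ) • radialWedgeCodiff ε α y := by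
  rw [isTransverseHomogeneous_iff]
  refine ⟨?_, fun y hy => ?_, ?_⟩
  · have h1 : ContDiffOn ℝ ∞ (fun y => ((metric n ε y y)⁻¹ * c) • α y) (cone n ε) :=
      (contDiffOn_inv_metric_self.mul contDiffOn_const).smul h.smooth
    have h2 : ContDiffOn ℝ ∞ (radialWedgeCodiff ε α) (cone n ε) := by
      cases b with
      | zero => exact contDiffOn_const
      | succ b => exact contDiffOn_radialWedge (contDiffOn_codiffSucc hε h.smooth)
    exact ((contDiffOn_box hε h.smooth).sub h1).sub (h2.const_smul (2 : ℝ))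
  · cases b with
    | zero => exact transverse_zero_deg _ _
    | succ b =>
      rw [transverse_iff, ← interior_apply, map_sub, map_sub, map_smul, map_smul, interior_apply,
        interior_apply, interior_apply, h.curryLeft_box hε hy,
        transverse_iff.1 (h.transverse_self hy), radialWedgeCodiff,
        ((h.codiffSucc hε).transverse_self hy).curryLeft_radialWedge hy]
      module
  · have h1 := homogeneousOn_box hε h.smooth h.homogeneousOn
    have h2 := HomogeneousOn.smul (E := Ambient n [⋀^Fin b]→L[ℝ] ℝ)
      homogeneousOn_inv_metric_self h.homogeneousOn
    have h3 : HomogeneousOn n ε (s - b - 2) (radialWedgeCodiff ε α) := by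
      cases b with
      | zero => exact fun y _ c _ => (smul_zero _).symm
      | succ b =>
        have := homogeneousOn_radialWedge (homogeneousOn_codiffSucc hε h.smooth h.homogeneousOn)
        rwa [sub_sub, one_add_one_eq_two] at this
    rw [show -2 + (s - b) = s - b - 2 by ring] at h2
    rw [show s - 2 - (b : ℝ) = s - b - 2 by ring]
    have h4 := HomogeneousOn.const_smul (E := Ambient n [⋀^Fin b]→L[ℝ] ℝ) h2 (-c)
    have h5 := HomogeneousOn.const_smul (E := Ambient n [⋀^Fin b]→L[ℝ] ℝ) h3 (-2)
    exact (HomogeneousOn.add (E := Ambient n [⋀^Fin b]→L[ℝ] ℝ)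
      (HomogeneousOn.add (E := Ambient n [⋀^Fin b]→L[ℝ] ℝ) h1 h4) h5).congr fun y _ => by
      module

end Box

/-! ### The (Anti-)de Sitter space -/

section Space

variable {n : ℕ} {ε H : ℝ}

theorem space_subset_cone (hε : ε = 1 ∨ ε = -1) (hH : 0 < H) (y : space n ε H) :
    (y : Ambient n) ∈ cone n ε := by
  have h : metric n ε y y = -ε * (H ^ 2)⁻¹ := y.2
  have h2 : ε * ε = 1 := by rcases hε with rfl | rfl <;> norm_num
  rw [cone, Set.mem_ofPred_eq, h, ← mul_assoc, neg_mul_neg, h2, one_mul]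
  positivity

theorem hFun_space (hε : ε = 1 ∨ ε = -1) (hH : 0 < H) (y : space n ε H) :
    hFun n ε (y : Ambient n) = H := by
  have h : metric n ε y y = -ε * (H ^ 2)⁻¹ := y.2
  have h2 : -ε * (-ε * (H ^ 2)⁻¹) = (H⁻¹) ^ 2 := by rcases hε with rfl | rfl <;> simp
  rw [hFun, abs_metric_self hε (space_subset_cone hε hH y), h, h2,
    Real.sqrt_sq (inv_pos.2 hH).le, inv_inv]

theorem normalVec_space (hε : ε = 1 ∨ ε = -1) (hH : 0 < H) (y : space n ε H) :
    normalVec n ε (y : Ambient n) = H • (y : Ambient n) := by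
  rw [normalVec, hFun_space hε hH]

theorem coe_proj {y : Ambient n} (hy : metric n ε y y ≠ 0) (v : Ambient n) :
    (proj ε y v : Ambient n) = v - ((metric n ε y y)⁻¹ * metric n ε y v) • y := by
  rw [proj, dif_pos hy]
  rfl

theorem metric_Tan {y : Ambient n} (x : Tan ε y) : metric n ε y x = 0 := x.2

theorem Tan_decomposition {y : Ambient n} (hy : metric n ε y y ≠ 0) {c : ℝ} (hc : c ≠ 0)
    (v : Ambient n) : ∃ x : Tan ε y, v = (Tan ε y).subtypeL x +
      (metric n ε (c • y) v / metric n ε (c • y) (c • y)) • c • y := by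
  refine ⟨proj ε y v, ?_⟩
  rw [Submodule.subtypeL_apply, coe_proj hy, smul_smul]
  simp only [map_smul, LinearMap.smul_apply, smul_eq_mul]
  have : c * metric n ε y v / (c * (c * metric n ε y y)) * c =
      (metric n ε y y)⁻¹ * metric n ε y v := by field_simp
  rw [this, sub_add_cancel]

/-- The normal of `Σ` is not isotropic, so that the induced metric is nondegenerate. -/
theorem metricS_nondegenerate (hε : ε = 1 ∨ ε = -1) {y : Ambient n} (hy : metric n ε y y ≠ 0) :
    (metricS ε y).Nondegenerate := by
  have h : ∀ x : Tan ε y, (∀ z : Tan ε y, metric n ε x z = 0) → x = 0 := by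
    intro x hx
    have h1 : ∀ v, metric n ε x v = 0 := by
      intro v
      obtain ⟨z, hz⟩ := Tan_decomposition hy one_ne_zero v
      rw [hz, map_add, Submodule.subtypeL_apply, hx, one_smul, map_smul,
        metric_comm (x : Ambient n) y, metric_Tan x, smul_zero, add_zero]
    refine Subtype.ext ?_
    rw [← sum_signs_metric_smul hε (x : Ambient n)]
    simp [h1]
  exact LinearMap.BilinForm.Nondegenerate.ofSeparatingLeft fun x hx => h x fun z => hx z

theorem finrank_Tan {y : Ambient n} (hy : metric n ε y y ≠ 0) :
    Module.finrank ℝ (Tan ε y) = n := by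
  have h1 : Module.finrank ℝ (LinearMap.range (metric n ε y)) + Module.finrank ℝ (Tan ε y) =
      Module.finrank ℝ (Ambient n) := LinearMap.finrank_range_add_finrank_ker (metric n ε y)
  have h2 : LinearMap.range (metric n ε y) = ⊤ :=
    LinearMap.range_eq_top.2 (LinearMap.surjective fun h => hy (by rw [h]; rfl))
  rw [h2, finrank_top, Module.finrank_self, Module.finrank_fin_fun] at h1
  omega

/-- A form is recovered from its restriction to `Σ` as soon as it is transverse. -/
theorem toAmbient_pullback (hε : ε = 1 ∨ ε = -1) (hH : 0 < H) {b : ℕ} {α : AForm n b}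
    (y : space n ε H) (hα : Transverse (y : Ambient n) (α y)) :
    toAmbient (pullback ε H α) y = α y := by
  have hy := metric_self_ne_zero (space_subset_cone hε hH y)
  ext v
  change α y (fun i => (proj ε (y : Ambient n) (v i) : Ambient n)) = α y v
  cases b with
  | zero => exact congrArg _ (Subsingleton.elim _ _)
  | succ b =>
    -- replace the arguments one at a time
    have key : ∀ S : Finset (Fin (b + 1)),
        α y (S.piecewise (fun i => (proj ε (y : Ambient n) (v i) : Ambient n)) v) = α y v := by
      intro S
      induction S using Finset.induction_on with
      | empty => simp
      | insert i S hi ih =>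
        rw [Finset.piecewise_insert, coe_proj hy, sub_eq_add_neg, ← neg_smul,
          ContinuousAlternatingMap.map_update_add, ContinuousAlternatingMap.map_update_smul,
          hα _ i (Function.update_self _ _ _), smul_zero, add_zero]
        rw [← ih]
        congr 1
        rw [Function.update_eq_iff]
        exact ⟨by simp [hi], fun _ _ => rfl⟩
    simpa using key Finset.univ

end Space

/-! ### Differential forms in the local parametrizations -/

section Chart

variable {n : ℕ} {ε H : ℝ}

/-- The map `v ↦ v + √(1 - v² / y²) y`. -/
def chartFun (ε : ℝ) (y : Ambient n) (v : Tan ε y) : Ambient n :=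
  (v : Ambient n) + Real.sqrt (1 - metric n ε v v / metric n ε y y) • y

/-- The open set on which `v ↦ v + √(1 - v² / y²) y` is smooth. -/
def chartDomain (ε : ℝ) (y : Ambient n) : Set (Tan ε y) :=
  {v | 0 < 1 - metric n ε v v / metric n ε y y}

theorem contDiff_metric_Tan (y : Ambient n) :
    ContDiff ℝ ∞ fun v : Tan ε y => 1 - metric n ε v v / metric n ε y y :=
  contDiff_const.sub (((contDiff_metric_self (ε := ε)).comp
    (Tan ε y).subtypeL.contDiff).div_const _)

theorem isOpen_chartDomain (y : Ambient n) : IsOpen (chartDomain ε y) :=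
  isOpen_lt continuous_const (contDiff_metric_Tan y).continuous

theorem zero_mem_chartDomain (y : Ambient n) : (0 : Tan ε y) ∈ chartDomain ε y := by
  simp [chartDomain]

theorem contDiffAt_chartFun {y : Ambient n} {v : Tan ε y} (hv : v ∈ chartDomain ε y) :
    ContDiffAt ℝ ∞ (chartFun ε y) v :=
  ((Tan ε y).subtypeL.contDiff.contDiffAt).add
    ((((contDiff_metric_Tan y).contDiffAt).sqrt (ne_of_gt hv)).smul contDiffAt_const)

theorem metric_chartFun {y : Ambient n} (hy : metric n ε y y ≠ 0) {v : Tan ε y}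
    (hv : v ∈ chartDomain ε y) :
    metric n ε (chartFun ε y v) (chartFun ε y v) = metric n ε y y := by
  have h1 := Real.mul_self_sqrt (le_of_lt hv)
  have h2 : metric n ε y (v : Ambient n) = 0 := v.2
  simp only [chartFun, map_add, map_smul, LinearMap.add_apply, LinearMap.smul_apply, smul_eq_mul,
    metric_comm (v : Ambient n) y, h2, mul_zero, add_zero, zero_add]
  rw [← mul_assoc, h1]
  field_simp
  ring

theorem coe_chart {y : space n ε H} (hy : metric n ε (y : Ambient n) y ≠ 0)
    {v : Tan ε (y : Ambient n)} (hv : v ∈ chartDomain ε (y : Ambient n)) :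
    (chart y v : Ambient n) = chartFun ε (y : Ambient n) v := by
  have h : chartFun ε (y : Ambient n) v ∈ space n ε H := (metric_chartFun hy hv).trans y.2
  rw [chart]
  exact congrArg Subtype.val (dif_pos h)

theorem chartFun_zero (y : Ambient n) : chartFun ε y 0 = y := by
  simp [chartFun]

theorem fderiv_chartFun_zero (y : Ambient n) :
    fderiv ℝ (chartFun ε y) 0 = (Tan ε y).subtypeL := by
  have h1 : HasFDerivAt (fun v : Tan ε y => metric n ε v v)
      (0 : Tan ε y →L[ℝ] ℝ) 0 := by
    have h2 := HasFDerivAt.comp (f := (Tan ε y).subtypeL) (g := fun z => metric n ε z z)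
      (0 : Tan ε y) (hasFDerivAt_metric_self _) (Tan ε y).subtypeL.hasFDerivAt
    refine h2.congr_fderiv ?_
    ext v
    simp
  have h3 : HasFDerivAt (fun v : Tan ε y => 1 - metric n ε v v / metric n ε y y)
      (0 : Tan ε y →L[ℝ] ℝ) 0 := by
    simp only [div_eq_mul_inv]
    simpa using (h1.mul_const (metric n ε y y)⁻¹).const_sub 1
  have h4 := ((h3.sqrt (by simp)).smul_const y)
  have h5 := ((Tan ε y).subtypeL.hasFDerivAt (x := 0)).add h4
  refine h5.fderiv.trans ?_
  ext v
  simp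

/-- The derivative of the parametrization takes values in the tangent spaces of `Σ`. -/
theorem metric_fderiv_chartFun {y : Ambient n} (hy : metric n ε y y ≠ 0) {v : Tan ε y}
    (hv : v ∈ chartDomain ε y) (x : Tan ε y) :
    metric n ε (chartFun ε y v) (fderiv ℝ (chartFun ε y) v x) = 0 := by
  have h1 := HasFDerivAt.comp (f := chartFun ε y) (g := fun z => metric n ε z z) v
    (hasFDerivAt_metric_self _)
    ((contDiffAt_chartFun hv).differentiableAt (by simp)).hasFDerivAt
  have h2 : (fun z => metric n ε z z) ∘ chartFun ε y =ᶠ[nhds v] fun _ => metric n ε y y := by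
    filter_upwards [(isOpen_chartDomain y).mem_nhds hv] with z hz using metric_chartFun hy hz
  have h3 := h1.unique ((hasFDerivAt_const _ v).congr_of_eventuallyEq h2)
  have h4 := congrArg (fun L => L x) h3
  simpa using h4

/-- The exterior derivative of `Σ` commutes with the restriction of ambient forms. -/
theorem extDerivS_pullback (hε : ε = 1 ∨ ε = -1) (hH : 0 < H) {b : ℕ} {α : AForm n b}
    (y : space n ε H) (hα : DifferentiableAt ℝ α y) :
    extDerivS (pullback ε H α) y = pullback ε H (extDeriv α) y := by
  have hy := metric_self_ne_zero (space_subset_cone hε hH y)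
  have h1 : inChart (pullback ε H α) y =ᶠ[nhds 0] fun v =>
      (α (chartFun ε (y : Ambient n) v)).compContinuousLinearMap
        (fderiv ℝ (chartFun ε (y : Ambient n)) v) := by
    filter_upwards [(isOpen_chartDomain (ε := ε) (y : Ambient n)).mem_nhds
      (zero_mem_chartDomain _)] with v hv
    have h2 : (fun w : Tan ε (y : Ambient n) => (chart y w : Ambient n)) =ᶠ[nhds v]
        chartFun ε (y : Ambient n) := by
      filter_upwards [(isOpen_chartDomain (y : Ambient n)).mem_nhds hv] with w hw
        using coe_chart hy hw
    ext x
    -- the projection in `inChart` is invisible: the derivative is already tangent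
    have hv' : metric n ε (chart y v : Ambient n) (chart y v) ≠ 0 :=
      metric_self_ne_zero (space_subset_cone hε hH _)
    change α (chart y v) (fun i => (proj ε (chart y v : Ambient n) (fderiv ℝ
      (fun w : Tan ε (y : Ambient n) => (chart y w : Ambient n)) v (x i)) : Ambient n)) = _
    simp only [coe_proj hv', h2.fderiv_eq]
    rw [coe_chart hy hv]
    simp only [metric_fderiv_chartFun hy hv, mul_zero, zero_smul, sub_zero]
    rfl
  have h2 := extDeriv_pullback (f := chartFun ε (y : Ambient n)) (x := 0) (r := ∞)
    (show DifferentiableAt ℝ α _ by rwa [chartFun_zero])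
    (contDiffAt_chartFun (zero_mem_chartDomain _))
    (by rw [minSmoothness_of_isRCLikeNormedField]; exact WithTop.coe_le_coe.2 le_top)
  rw [extDerivS, h1.extDeriv_eq, h2, chartFun_zero, fderiv_chartFun_zero]
  rfl

end Chart

/-! ### The codifferential of `Σ` -/

section Codifferential

variable {n b : ℕ} {ε H s : ℝ}

theorem hodgeStar_smul_left {V : Type*} [NormedAddCommGroup V] [NormedSpace ℝ V]
    [FiniteDimensional ℝ V] (g : LinearMap.BilinForm ℝ V) {m p q : ℕ} (c : ℝ)
    (w : V [⋀^Fin m]→L[ℝ] ℝ) (h : m = q + p) (α : V [⋀^Fin p]→L[ℝ] ℝ) :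
    hodgeStar g (c • w) h α = c • hodgeStar g w h α := by
  rw [hodgeStar_eq, hodgeStar_eq, fullContract_smul_left, smul_comm]

/-- A transverse form of degree larger than `n` vanishes. -/
theorem eq_zero_of_curryLeft_eq_zero {y : Ambient n} (hy : metric n ε y y ≠ 0) {q : ℕ}
    {w : Ambient n [⋀^Fin (q + 1)]→L[ℝ] ℝ} (hq : n < q + 1) (hw : w.curryLeft y = 0) : w = 0 := by
  have h1 := (transverse_iff.2 hw).curryLeft_wedge (flat (metric n ε) y)
  rw [eq_zero_of_finrank_lt (by simp; omega) (wedge (flat (metric n ε) y) w),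
    ContinuousAlternatingMap.curryLeft_zero, _root_.zero_apply, eq_comm, smul_eq_zero] at h1
  exact h1.resolve_left hy

theorem volS_ne_zero (hε : ε = 1 ∨ ε = -1) (hH : 0 < H) (y : space n ε H) :
    volS ε (y : Ambient n) ≠ 0 := by
  intro h
  have h1 : ((vol n).curryLeft (normalVec n ε (y : Ambient n))).compContinuousLinearMap
      (Tan ε (y : Ambient n)).subtypeL = 0 :=
    (smul_eq_zero.1 h).resolve_left (pow_ne_zero _ (by norm_num))
  have h2 : Transverse (y : Ambient n) ((vol n).curryLeft (normalVec n ε (y : Ambient n))) := by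
    cases n with
    | zero => exact transverse_zero_deg _ _
    | succ n =>
      rw [transverse_iff, normalVec_space hε hH, map_smul, curryLeft_smul, _root_.smul_apply,
        curryLeft_same, smul_zero]
  have h3 := toAmbient_pullback hε hH
    (α := fun _ => (vol n).curryLeft (normalVec n ε (y : Ambient n))) y h2
  have h4 : (vol n).curryLeft (normalVec n ε (y : Ambient n)) = 0 := by
    rw [← h3]
    change (((vol n).curryLeft (normalVec n ε (y : Ambient n))).compContinuousLinearMap
      (Tan ε (y : Ambient n)).subtypeL).compContinuousLinearMap _ = 0
    rw [h1]
    rfl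
  rw [normalVec_space hε hH, map_smul, smul_eq_zero, or_iff_right hH.ne'] at h4
  exact vol_ne_zero (eq_zero_of_curryLeft_eq_zero
    (metric_self_ne_zero (space_subset_cone hε hH y)) (by omega) h4)

/-- The Hodge operator of `Σ` as the restriction of the contraction of the ambient one with the
normal. -/
theorem starS_pullback (hε : ε = 1 ∨ ε = -1) (hH : 0 < H) {p q : ℕ} (h : n = q + p)
    (h' : n + 1 = q + 1 + p) (α : AForm n p) :
    starS h (pullback ε H α) =
      pullback ε H (fun z => ((-1) ^ (n + p) * H) • (starA ε h' α z).curryLeft z) := by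
  funext y
  have hy := metric_self_ne_zero (space_subset_cone hε hH y)
  have h1 := curryLeft_hodgeStar_comp metric_comm (metric_nondegenerate hε)
    (metricS_nondegenerate hε hy) (Tan ε (y : Ambient n)).subtypeL (fun _ _ => rfl)
    (e := H • (y : Ambient n))
    (fun x => by
      rw [map_smul, LinearMap.smul_apply, Submodule.subtypeL_apply, metric_Tan x, smul_zero])
    (Tan_decomposition hy hH.ne') h' h (vol n) (α y)
  have h2 : starS h (pullback ε H α) y = (-1 : ℝ) ^ n • hodgeStar (metricS ε (y : Ambient n))
      (((vol n).curryLeft (H • (y : Ambient n))).compContinuousLinearMap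
        (Tan ε (y : Ambient n)).subtypeL) h
      ((α y).compContinuousLinearMap (Tan ε (y : Ambient n)).subtypeL) := by
    rw [← normalVec_space hε hH, ← hodgeStar_smul_left]
    rfl
  have h3 : pullback ε H (fun z => ((-1) ^ (n + p) * H) • (starA ε h' α z).curryLeft z) y =
      ((-1 : ℝ) ^ (n + p)) • ((hodgeStar (metric n ε) (vol n) h' (α y)).curryLeft
        (H • (y : Ambient n))).compContinuousLinearMap (Tan ε (y : Ambient n)).subtypeL := by
    change (((-1 : ℝ) ^ (n + p) * H) • (hodgeStar (metric n ε) (vol n) h' (α y)).curryLeft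
      (y : Ambient n)).compContinuousLinearMap (Tan ε (y : Ambient n)).subtypeL = _
    rw [map_smul, mul_smul]
    rfl
  rw [h2, h3, h1, smul_smul, ← pow_add, add_assoc, pow_add, Even.neg_one_pow (n := p + p) ⟨p, rfl⟩,
    mul_one]

/-- The restriction of `e^n` to `Σ` vanishes. -/
theorem pullback_radialWedge (α : AForm n b) (y : space n ε H) :
    pullback ε H (radialWedge ε α) y = 0 := by
  have h1 : (flat (metric n ε) (y : Ambient n)).comp (Tan ε (y : Ambient n)).subtypeL = 0 := by
    ext x
    exact metric_Tan x
  change ((metric n ε (y : Ambient n) y)⁻¹ • wedge (flat (metric n ε) (y : Ambient n))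
    (α y)).compContinuousLinearMap (Tan ε (y : Ambient n)).subtypeL = 0
  rw [← compContinuousLinearMapCLM_apply, map_smul, compContinuousLinearMapCLM_apply,
    wedge_compContinuousLinearMap, h1]
  ext v
  simp [wedge_apply]

/-- The exterior derivative on `Σ` of the dual of a transverse homogeneous form. -/
theorem extDerivS_starS (hε : ε = 1 ∨ ε = -1) (hH : 0 < H) {p q : ℕ} {α : AForm n (p + 1)}
    (h : IsTransverseHomogeneous ε s α) (h1 : n = q + (p + 1)) (h2 : n = q + 1 + p)
    (y : space n ε H) :
    extDerivS (starS h1 (pullback ε H α)) y =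
      (-1 : ℝ) ^ (p + 1) • starS h2 (pullback ε H (codiffSucc ε α)) y := by
  have hyc := space_subset_cone hε hH y
  have hy := metric_self_ne_zero hyc
  have h1' : n + 1 = q + 1 + (p + 1) := by omega
  have h2' : n + 1 = q + 1 + 1 + p := by omega
  have hd := h.differentiableAt hyc
  have hω : HasFDerivAt (starA ε h1' α)
      ((hodgeStarCLM (metric n ε) (vol n) h1').comp (fderiv ℝ α y)) y := by
    have := hasFDerivAt_clm_comp (hodgeStarCLM (metric n ε) (vol n) h1') hd
    simp only [hodgeStarCLM_apply] at this
    exact this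
  have hF := hasFDerivAt_curryLeft_self hω.differentiableAt
  have hG : DifferentiableAt ℝ
      (fun z => ((-1 : ℝ) ^ (n + (p + 1)) * H) • (starA ε h1' α z).curryLeft z) y :=
    hF.differentiableAt.fun_const_smul _
  rw [starS_pullback hε hH h1 h1', starS_pullback hε hH h2 h2', extDerivS_pullback hε hH y hG]
  -- on the cone the dual of `α` is homogeneous, and its restriction to `Σ` vanishes
  have h3 : fderiv ℝ (starA ε h1' α) y y = (s - (p + 1 : ℕ)) • starA ε h1' α y := by
    rw [hω.fderiv, ContinuousLinearMap.comp_apply, h.homogeneousOn.fderiv_apply_self hyc hd,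
      map_smul, hodgeStarCLM_apply]
    rfl
  have h4 : (starA ε h1' α y).compContinuousLinearMap (Tan ε (y : Ambient n)).subtypeL = 0 :=
    hodgeStar_comp_eq_zero metric_comm (metric_nondegenerate hε) (by simp) _ h1' hy
      (transverse_iff.1 (h.transverse_self hyc)) _ metric_Tan
  have h5 : extDeriv (starA ε h1' α) y = (-1 : ℝ) ^ (p + 1) • starA ε h2' (codiffSucc ε α) y := by
    rw [extDeriv_starA hε h1' h2' hd, starA, codiffSucc_eq_divergence hε hd, ← hodgeStarCLM_apply,
      ← hodgeStarCLM_apply, map_smul, smul_smul]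
    congr 1
    rw [pow_succ]
    ring
  have h6 : extDeriv (fun z => ((-1) ^ (n + (p + 1)) * H) • (starA ε h1' α z).curryLeft z) y =
      ((-1) ^ (n + (p + 1)) * H) • extDeriv (fun z => (starA ε h1' α z).curryLeft z) y :=
    extDeriv_smul (x := (y : Ambient n)) ((-1 : ℝ) ^ (n + (p + 1)) * H) _
  rw [extDeriv_curryLeft_self hω.differentiableAt, h3, h5] at h6
  change (extDeriv (fun z => ((-1 : ℝ) ^ (n + (p + 1)) * H) • (starA ε h1' α z).curryLeft z)
    y).compContinuousLinearMap (Tan ε (y : Ambient n)).subtypeL = (-1 : ℝ) ^ (p + 1) •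
      (((-1 : ℝ) ^ (n + p) * H) • (starA ε h2' (codiffSucc ε α) y).curryLeft
        (y : Ambient n)).compContinuousLinearMap (Tan ε (y : Ambient n)).subtypeL
  rw [h6, curryLeft_smul, _root_.smul_apply]
  simp only [← compContinuousLinearMapCLM_apply] at h4 ⊢
  simp only [map_smul, map_sub, map_add, h4, ← add_assoc, pow_succ]
  module

/-- The codifferential of `Σ` is the restriction of the ambient one, on transverse homogeneous
extensions. -/
theorem codiffSSucc_pullback (hε : ε = 1 ∨ ε = -1) (hH : 0 < H) {p : ℕ} {α : AForm n (p + 1)}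
    (h : IsTransverseHomogeneous ε s α) :
    codiffSSucc (pullback ε H α) = pullback ε H (codiffSucc ε α) := by
  funext y
  have hyc := space_subset_cone hε hH y
  have hy := metric_self_ne_zero hyc
  unfold codiffSSucc
  split_ifs with hp
  · simp only
    have h2 : n = n - (p + 1) + 1 + p := by omega
    have hsym : ∀ u v : Tan ε (y : Ambient n),
        metricS ε (y : Ambient n) u v = metricS ε (y : Ambient n) v u :=
      fun u v => metric_comm (u : Ambient n) (v : Ambient n)
    rw [starInvS, extDerivS_starS hε hH h _ h2, starS, ← hodgeStarCLM_apply, ← map_smul,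
      hodgeStarCLM_apply, hodgeStarInv_hodgeStar hsym
        (metricS_nondegenerate hε hy) (finrank_Tan hy) (volS_ne_zero hε hH y), smul_smul,
      ← pow_add, Even.neg_one_pow ⟨p + 1, rfl⟩, one_smul]
  · -- in degree larger than `n` a transverse form vanishes
    have h1 : α =ᶠ[nhds (y : Ambient n)] fun _ => 0 := by
      filter_upwards [isOpen_cone.mem_nhds hyc] with z hz
      exact eq_zero_of_curryLeft_eq_zero (metric_self_ne_zero hz) (by omega)
        (transverse_iff.1 (h.transverse_self hz))
    have h2 : codiffSucc ε α y = 0 := by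
      rw [codiffSucc_eq_divergence hε (h.differentiableAt hyc), h1.fderiv_eq, fderiv_fun_const,
        Pi.zero_apply, ← divergenceCLM_apply, map_zero, smul_zero]
    rw [pullback, h2]
    rfl

end Codifferential

/-! ### The Laplace-de Rham operator of `Σ` -/

section BoxSpace

variable {n b : ℕ} {ε H s : ℝ}

theorem IsTransverseHomogeneous.congr {α α' : AForm n b} (h : IsTransverseHomogeneous ε s α)
    (h' : ∀ y ∈ cone n ε, α' y = α y) : IsTransverseHomogeneous ε s α' where
  smooth := h.smooth.congr h'
  transverse y hy := by
    rw [h' y hy]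
    exact h.transverse y hy
  homogeneous y hy c hc := by
    rw [h' y hy, h' _ (smul_mem_cone hy hc)]
    exact h.homogeneous y hy c hc

theorem isTransverseHomogeneous_zero :
    IsTransverseHomogeneous ε s fun _ => (0 : Ambient n [⋀^Fin b]→L[ℝ] ℝ) where
  smooth := contDiffOn_const
  transverse _ _ _ _ _ := rfl
  homogeneous _ _ _ _ := (smul_zero _).symm

/-- The transverse homogeneous extension of the exterior derivative on `Σ` of the restriction of a
transverse `s`-homogeneous form `α`: the projection `dα - s h e^n ∧ α` of `dα`. -/
theorem IsTransverseHomogeneous.extDeriv_sub {α : AForm n b} (h : IsTransverseHomogeneous ε s α) :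
    IsTransverseHomogeneous ε s fun y => extDeriv α y - s • radialWedge ε α y := by
  rw [isTransverseHomogeneous_iff]
  refine ⟨(contDiffOn_extDeriv h.smooth).sub ((contDiffOn_radialWedge h.smooth).const_smul s),
    fun y hy => ?_, ?_⟩
  · rw [transverse_iff, ← interior_apply, map_sub, map_smul, interior_apply, interior_apply,
      h.curryLeft_extDeriv hy, (h.transverse_self hy).curryLeft_radialWedge hy, sub_self]
  · have h1 := homogeneousOn_extDeriv h.homogeneousOn
    have h2 := HomogeneousOn.const_smul (E := Ambient n [⋀^Fin (b + 1)]→L[ℝ] ℝ)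
      (homogeneousOn_radialWedge (ε := ε) h.homogeneousOn) (-s)
    rw [show s - ((b + 1 : ℕ) : ℝ) = s - b - 1 by push_cast; ring]
    exact (HomogeneousOn.add (E := Ambient n [⋀^Fin (b + 1)]→L[ℝ] ℝ) h1 h2).congr fun y _ => by
      module

theorem extDerivS_pullback_eq (hε : ε = 1 ∨ ε = -1) (hH : 0 < H) {α : AForm n b}
    (h : IsTransverseHomogeneous ε s α) :
    extDerivS (pullback ε H α) =
      pullback ε H fun y => extDeriv α y - s • radialWedge ε α y := by
  funext y
  have h1 := pullback_radialWedge α y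
  rw [extDerivS_pullback hε hH y (h.differentiableAt (space_subset_cone hε hH y))]
  simp only [pullback, ← compContinuousLinearMapCLM_apply] at h1 ⊢
  rw [map_sub, map_smul, h1]
  module

theorem clm_fderiv_sub_smul {E F G : Type*} [NormedAddCommGroup E] [NormedSpace ℝ E]
    [NormedAddCommGroup F] [NormedSpace ℝ F] [NormedAddCommGroup G] [NormedSpace ℝ G]
    (L : (E →L[ℝ] F) →L[ℝ] G) (c : ℝ) {f g : E → F} {y : E} (hf : DifferentiableAt ℝ f y)
    (hg : DifferentiableAt ℝ g y) : L (fderiv ℝ (fun z => f z - c • g z) y) =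
      L (fderiv ℝ f y) - c • L (fderiv ℝ g y) := by
  rw [fderiv_fun_sub hf (hg.fun_const_smul c), fderiv_fun_const_smul hg, map_sub, map_smul]

/-- The codifferential on the cone of the transverse homogeneous extension of the exterior
derivative. -/
theorem IsTransverseHomogeneous.codiffSucc_extDeriv_sub (hε : ε = 1 ∨ ε = -1) {α : AForm n b}
    (h : IsTransverseHomogeneous ε s α) {y : Ambient n} (hy : y ∈ cone n ε) :
    DS.codiffSucc ε (fun z => extDeriv α z - s • radialWedge ε α z) y =
      DS.codiffSucc ε (extDeriv α) y +
        ((metric n ε y y)⁻¹ * (s * (s + n - 1 - 2 * b))) • α y +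
          s • radialWedgeCodiff ε α y := by
  have hd := differentiableAt_of_contDiffOn_cone (contDiffOn_extDeriv h.smooth) hy
  have hr := differentiableAt_of_contDiffOn_cone (contDiffOn_radialWedge h.smooth) hy
  have h1 := codiffSucc_eq_divergence hε hr
  rw [h.codiffSucc_radialWedge hε hy, ← divergenceCLM_apply] at h1
  have h2 := clm_fderiv_sub_smul (F := Ambient n [⋀^Fin (b + 1)]→L[ℝ] ℝ)
    (G := Ambient n [⋀^Fin b]→L[ℝ] ℝ) (divergenceCLM n ε b) s hd hr
  rw [codiffSucc_eq_divergence hε (hd.fun_sub (hr.fun_const_smul s)),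
    codiffSucc_eq_divergence hε hd, ← divergenceCLM_apply, ← divergenceCLM_apply, h2]
  linear_combination (norm := module) s • h1

/-- `□_Σ` as a restriction. The multiple of `e^n ∧ δα` does not contribute: it is chosen so as to
make the restricted form transverse. -/
theorem boxS_pullback (hε : ε = 1 ∨ ε = -1) (hH : 0 < H) {α : AForm n b}
    (h : IsTransverseHomogeneous ε s α) (y : space n ε H) :
    boxS (pullback ε H α) y = pullback ε H (fun y => box ε α y -
      ((metric n ε y y)⁻¹ * (s * (s + n - 1 - 2 * b))) • α y -
        (2 : ℝ) • radialWedgeCodiff ε α y) y := by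
  have hy := space_subset_cone hε hH y
  have h1 := congrFun (codiffSSucc_pullback hε hH h.extDeriv_sub) y
  rw [← extDerivS_pullback_eq hε hH h] at h1
  have h2 := h.codiffSucc_extDeriv_sub hε hy
  cases b with
  | zero =>
    simp only [boxS, box, radialWedgeCodiff] at h2 ⊢
    rw [h1]
    simp only [pullback, ← compContinuousLinearMapCLM_apply]
    rw [h2]
    simp only [map_sub, map_add, map_smul, map_neg, smul_zero, map_zero]
    module
  | succ b =>
    have h3 := pullback_radialWedge (DS.codiffSucc ε α) y
    simp only [boxS, box, radialWedgeCodiff] at h2 ⊢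
    rw [h1, codiffSSucc_pullback hε hH h,
      extDerivS_pullback hε hH y ((h.codiffSucc hε).differentiableAt hy)]
    simp only [pullback, ← compContinuousLinearMapCLM_apply] at h3 ⊢
    rw [h2]
    simp only [map_sub, map_add, map_smul, map_neg, h3]
    module

end BoxSpace

end DS

end

theorem theorem2 (n : ℕ) (hn : 1 ≤ n) (ε : ℝ) (hε : ε = 1 ∨ ε = -1) (H : ℝ) (hH : 0 < H)
    (b : ℕ) (s : ℝ) (β : DS.SForm n ε H b) (hβ : DS.SmoothForm β)
    (βs : DS.AForm n b) (hβs : DS.IsTransverseHomogeneous ε s βs)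
    (hext : DS.pullback ε H βs = β) :
    -- `δ_Σ β = δ_{n+1} β_s` at every point of `Σ`
    (∀ y : DS.space n ε H, DS.toAmbient (DS.codiffS β) y = DS.codiff ε βs y) ∧
    -- `δ_{n+1} β_s` is transverse and `(s - 2)`-homogeneous
    DS.IsTransverseHomogeneous ε (s - 2) (DS.codiff ε βs) ∧
    -- `□_Σ β = □_{n+1} β_s - η^{nn} H² s (s + n - 1 - 2b) β_s - 2 H e^n ∧ δ_{n+1} β_s`
    -- at every point of `Σ`, with `η^{nn} = -ε`
    (∀ y : DS.space n ε H, DS.toAmbient (DS.boxS β) y =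
      DS.box ε βs y - ((-ε) * H ^ 2 * (s * (s + n - 1 - 2 * b))) • βs y
        - (2 * H) • DS.normalWedgeCodiff ε βs y) ∧
    -- the right-hand side, continued to the cone with `h` in place of its value `H` on `Σ`,
    -- is transverse and `(s - 2)`-homogeneous
    DS.IsTransverseHomogeneous ε (s - 2) (fun y =>
      DS.box ε βs y - ((-ε) * DS.hFun n ε y ^ 2 * (s * (s + n - 1 - 2 * b))) • βs y
        - (2 * DS.hFun n ε y) • DS.normalWedgeCodiff ε βs y) := by
  open DS in
  subst hext
  refine ⟨fun y => ?_, ?_, fun y => ?_, ?_⟩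
  · cases b with
    | zero => rfl
    | succ b =>
      change toAmbient (codiffSSucc (pullback ε H βs)) y = _
      rw [codiffSSucc_pullback hε hH hβs]
      exact toAmbient_pullback hε hH y
        ((hβs.codiffSucc hε).transverse_self (space_subset_cone hε hH y))
  · cases b with
    | zero => exact isTransverseHomogeneous_zero
    | succ b => exact hβs.codiffSucc hε
  · have hy := space_subset_cone hε hH y
    have h1 := hβs.box_sub hε (s * (s + n - 1 - 2 * b))
    have h2 := toAmbient_pullback (α := fun y => box ε βs y -
      ((metric n ε y y)⁻¹ * (s * (s + n - 1 - 2 * b))) • βs y -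
        (2 : ℝ) • radialWedgeCodiff ε βs y) hε hH y (h1.transverse_self hy)
    have h3 : toAmbient (boxS (pullback ε H βs)) y = toAmbient (pullback ε H fun y =>
        box ε βs y - ((metric n ε y y)⁻¹ * (s * (s + n - 1 - 2 * b))) • βs y -
          (2 : ℝ) • radialWedgeCodiff ε βs y) y := by
      rw [toAmbient, boxS_pullback hε hH hβs]
      rfl
    rw [h3, h2, ← neg_mul_hFun_sq hε hy, ← hFun_smul_normalWedgeCodiff hε βs hy,
      hFun_space hε hH, mul_smul 2 H]
  · refine (hβs.box_sub hε (s * (s + n - 1 - 2 * b))).congr fun y hy => ?_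
    rw [← neg_mul_hFun_sq hε hy, ← hFun_smul_normalWedgeCodiff hε βs hy, mul_smul 2]
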